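/- In the $N$-experts problem with switching cost $D\ge 0$ and known horizon $T$, in each round $t=1,\dots,T$ a randomized online algorithm chooses an expert $i_t\in\{1,\dots,N\}$, after which a loss vector $l_t\in[0,1]^N$ is revealed. The loss vectors are fixed in advance (oblivious adversary), and $i_t$ depends only on $l_1,\dots,l_{t-1}$ and the algorithm's internal randomness. Computation is measured on a random access machine with real-valued memory cells, on which arithmetic operations, comparisons, exponentiation, evaluating the error function, and sampling uniformly from $[0,1]$ cost one step each. There are an algorithm (a single program that receives $N$, $T$, $D$ as input) and a universal constant $C>0$ such that for all $N\ge 1$, $T\ge 2$ and $D\ge 0$: (1) for every loss sequence and every outcome of its random numbers, the algorithm uses at most $C\,N\log T$ steps in each round, and at most $C\,N\log T$ steps of initialization before the first round; (2) for every interval $I=\{t_0+1,\dots,t_0+k\}\subseteq\{1,\dots,T\}$ and every loss sequence, $$\mathbb{E}\Big[\sum_{t\in I} l_t(i_t)+D\sum_{t\in I\setminus\{t_0+1\}}\mathbf 1[i_t\ne i_{t-1}]\Big]\le \min_{1\le i\le N}\sum_{t\in I} l_t(i)+C\sqrt{(D+1)\,|I|\,\log(NT)}.$$ -/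

import Mathlib

/-! # Online experts with switching costs, and a real-number random access machine

Algorithms are programs for a uniform-cost real RAM: arithmetic, comparisons, exponentiation, the
error function and drawing a uniform number from `[0,1]` cost one step each. -/

namespace Experts

/-- The error function in the normalization `∫₀ˣ exp (-s²/2) ds`. -/
noncomputable def erf (x : ℝ) : ℝ := ∫ s in (0 : ℝ)..x, Real.exp (-s ^ 2 / 2)

/-- Memory of the machine: integer registers, arrays of real cells, and the number of random
numbers drawn so far. -/
structure State where
  nat : ℕ → ℕ
  real : ℕ → ℕ → ℝ
  drawn : ℕ

/-- Integer expressions (`sub` is truncated subtraction). -/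
inductive NatExpr where
  | lit (n : ℕ)
  | var (x : ℕ)
  | add (e f : NatExpr)
  | sub (e f : NatExpr)
  | mul (e f : NatExpr)

namespace NatExpr

def eval (s : State) : NatExpr → ℕ
  | lit n => n
  | var x => s.nat x
  | add e f => e.eval s + f.eval s
  | sub e f => e.eval s - f.eval s
  | mul e f => e.eval s * f.eval s

/-- Number of operations needed to evaluate the expression. -/
def cost : NatExpr → ℕ
  | lit _ => 1
  | var _ => 1
  | add e f => e.cost + f.cost + 1
  | sub e f => e.cost + f.cost + 1
  | mul e f => e.cost + f.cost + 1

end NatExpr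

/-- Real expressions; `get a e` reads cell `e` of array `a`. Constants are rational. There is no
way to turn a real number into an integer except by branching on comparisons. -/
inductive RealExpr where
  | lit (q : ℚ)
  | ofNat (e : NatExpr)
  | get (a : ℕ) (e : NatExpr)
  | add (e f : RealExpr)
  | sub (e f : RealExpr)
  | mul (e f : RealExpr)
  | div (e f : RealExpr)
  | exp (e : RealExpr)
  | pow (e f : RealExpr)
  | erf (e : RealExpr)

namespace RealExpr

open Classical in
/-- Division by zero and powers of non-positive bases return `0`. -/
noncomputable def eval (s : State) : RealExpr → ℝ
  | lit q => (q : ℝ)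
  | ofNat e => (e.eval s : ℝ)
  | get a e => s.real a (e.eval s)
  | add e f => e.eval s + f.eval s
  | sub e f => e.eval s - f.eval s
  | mul e f => e.eval s * f.eval s
  | div e f => e.eval s / f.eval s
  | exp e => Real.exp (e.eval s)
  | pow e f => if 0 < e.eval s then e.eval s ^ f.eval s else 0
  | erf e => Experts.erf (e.eval s)

/-- Number of operations needed to evaluate the expression. -/
def cost : RealExpr → ℕ
  | lit _ => 1
  | ofNat e => e.cost + 1
  | get _ e => e.cost + 1
  | add e f => e.cost + f.cost + 1
  | sub e f => e.cost + f.cost + 1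
  | mul e f => e.cost + f.cost + 1
  | div e f => e.cost + f.cost + 1
  | exp e => e.cost + 1
  | pow e f => e.cost + f.cost + 1
  | erf e => e.cost + 1

end RealExpr

/-- Tests. -/
inductive Test where
  | natLt (e f : NatExpr)
  | natEq (e f : NatExpr)
  | realLt (e f : RealExpr)
  | neg (b : Test)
  | conj (b c : Test)

namespace Test

def Holds (s : State) : Test → Prop
  | natLt e f => e.eval s < f.eval s
  | natEq e f => e.eval s = f.eval s
  | realLt e f => e.eval s < f.eval s
  | neg b => ¬ b.Holds s
  | conj b c => b.Holds s ∧ c.Holds s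

/-- Number of operations needed to evaluate the test. -/
def cost : Test → ℕ
  | natLt e f => e.cost + f.cost + 1
  | natEq e f => e.cost + f.cost + 1
  | realLt e f => e.cost + f.cost + 1
  | neg b => b.cost + 1
  | conj b c => b.cost + c.cost + 1

end Test

/-- Programs. `setReal a e f` stores `f` in cell `e` of array `a`, `sample a e` stores there a
fresh uniform random number, and `loop n b c` repeats `c` while `b` holds, but at most as often as
the value that `n` has when the loop is entered. -/
inductive Cmd where
  | skip
  | setNat (x : ℕ) (e : NatExpr)
  | setReal (a : ℕ) (e : NatExpr) (f : RealExpr)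
  | sample (a : ℕ) (e : NatExpr)
  | seq (c d : Cmd)
  | ite (b : Test) (c d : Cmd)
  | loop (n : NatExpr) (b : Test) (c : Cmd)

namespace State

def setNat (s : State) (x v : ℕ) : State :=
  { s with nat := Function.update s.nat x v }

noncomputable def setReal (s : State) (a i : ℕ) (v : ℝ) : State :=
  { s with real := Function.update s.real a (Function.update (s.real a) i v) }

end State

open Classical in
/-- At most `n` executions of `body` while `b` holds, with the number of steps used. -/
noncomputable def iter (b : Test) (body : State → State × ℕ) : ℕ → State → State × ℕ
  | 0, s => (s, 1)
  | n + 1, s =>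
    if b.Holds s then
      ((iter b body n (body s).1).1,
        b.cost + 1 + (body s).2 + (iter b body n (body s).1).2)
    else (s, b.cost + 1)

open Classical in
/-- Execution of a program on the random numbers `ω 0, ω 1, …`: the final state and the number of
steps used. -/
noncomputable def exec (ω : ℕ → unitInterval) : Cmd → State → State × ℕ
  | .skip, s => (s, 1)
  | .setNat x e, s => (s.setNat x (e.eval s), e.cost + 1)
  | .setReal a e f, s => (s.setReal a (e.eval s) (f.eval s), e.cost + f.cost + 1)
  | .sample a e, s =>
      ({ s.setReal a (e.eval s) (ω s.drawn : ℝ) with drawn := s.drawn + 1 }, e.cost + 1)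
  | .seq c d, s => ((exec ω d (exec ω c s).1).1, (exec ω c s).2 + (exec ω d (exec ω c s).1).2)
  | .ite b c d, s =>
      if b.Holds s then ((exec ω c s).1, b.cost + 1 + (exec ω c s).2)
      else ((exec ω d s).1, b.cost + 1 + (exec ω d s).2)
  | .loop n b c, s =>
      ((iter b (exec ω c) (n.eval s) s).1, n.cost + 1 + (iter b (exec ω c) (n.eval s) s).2)

/-- An algorithm for the experts problem: `init` is executed once, before the first round; in each
round `choose` is executed to select an expert, then the loss vector is revealed, then `update` is
executed. -/
structure Algorithm where
  init : Cmd
  choose : Cmd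
  update : Cmd

/-- The input: integer registers `0` and `1` hold `N` and `T`, cell `0` of array `1` holds `D`, and
everything else is `0`. -/
noncomputable def initialState (N T : ℕ) (D : ℝ) : State where
  nat := fun x => if x = 0 then N else if x = 1 then T else 0
  real := fun a i => if a = 1 ∧ i = 0 then D else 0
  drawn := 0

/-- The loss vector `v` is revealed: it is written to array `0`. -/
noncomputable def State.reveal {N : ℕ} (s : State) (v : Fin N → ℝ) : State :=
  { s with real := Function.update s.real 0 (fun i => if h : i < N then v ⟨i, h⟩ else 0) }

namespace Algorithm

variable (A : Algorithm) {N : ℕ} (T : ℕ) (D : ℝ) (l : ℕ → Fin N → ℝ) (ω : ℕ → unitInterval)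

/-- The state after `t` complete rounds; `l t` is the loss vector of round `t ≥ 1`. -/
noncomputable def stateAfter : ℕ → State
  | 0 => (exec ω A.init (initialState N T D)).1
  | t + 1 => (exec ω A.update ((exec ω A.choose (stateAfter t)).1.reveal (l (t + 1)))).1

/-- The expert chosen in round `t ≥ 1` (experts are numbered `0, …, N - 1`): the content of integer
register `2` after `choose`. -/
noncomputable def action (t : ℕ) : ℕ :=
  (exec ω A.choose (A.stateAfter T D l ω (t - 1))).1.nat 2

/-- The number of steps used before the first round. -/
noncomputable def initCost (N T : ℕ) (D : ℝ) (ω : ℕ → unitInterval) : ℕ :=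
  (exec ω A.init (initialState N T D)).2

/-- The number of steps used in round `t ≥ 1`. -/
noncomputable def roundCost (t : ℕ) : ℕ :=
  (exec ω A.choose (A.stateAfter T D l ω (t - 1))).2 +
    (exec ω A.update
      ((exec ω A.choose (A.stateAfter T D l ω (t - 1))).1.reveal (l t))).2

/-- The loss suffered in round `t` through the chosen expert. -/
noncomputable def actionLoss (t : ℕ) : ℝ :=
  if h : A.action T D l ω t < N then l t ⟨A.action T D l ω t, h⟩ else 0

/-- The total loss on the interval `{t₀ + 1, …, t₀ + k}`, including the costs of the switches
inside the interval. -/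
noncomputable def intervalLoss (t₀ k : ℕ) : ℝ :=
  ∑ t ∈ Finset.Ioc t₀ (t₀ + k), A.actionLoss T D l ω t +
    D * ∑ t ∈ Finset.Ioc (t₀ + 1) (t₀ + k),
      (if A.action T D l ω t ≠ A.action T D l ω (t - 1) then (1 : ℝ) else 0)

end Algorithm

/-- The loss vectors of all `T` rounds lie in `[0,1]^N`. -/
def IsLossSequence {N : ℕ} (T : ℕ) (l : ℕ → Fin N → ℝ) : Prop :=
  ∀ t ∈ Finset.Icc 1 T, ∀ i, l t i ∈ Set.Icc (0 : ℝ) 1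

/-- The law of an i.i.d. sequence of uniform random numbers in `[0,1]`. -/
noncomputable def coinLaw : MeasureTheory.Measure (ℕ → unitInterval) :=
  MeasureTheory.Measure.infinitePi (fun _ => MeasureTheory.volume)

/-- `A` always chooses one of the `N` experts, and it uses at most `B` steps before the first round
and at most `B` steps in each round, for all losses and all outcomes of the random numbers. -/
def RunsWithin (A : Algorithm) (N T : ℕ) (D B : ℝ) : Prop :=
  ∀ l : ℕ → Fin N → ℝ, IsLossSequence T l → ∀ ω : ℕ → unitInterval,
    (A.initCost N T D ω : ℝ) ≤ B ∧
    ∀ t ∈ Finset.Icc 1 T, A.action T D l ω t < N ∧ (A.roundCost T D l ω t : ℝ) ≤ B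

/-- The regret of `A` on the interval `{t₀ + 1, …, t₀ + k}`, switching costs included, is at most
`R` for every loss sequence fixed in advance. -/
def HasRegretBound (A : Algorithm) (N T : ℕ) (D : ℝ) (t₀ k : ℕ) (R : ℝ) : Prop :=
  ∀ l : ℕ → Fin N → ℝ, IsLossSequence T l →
    MeasureTheory.Integrable (fun ω => A.intervalLoss T D l ω t₀ k) coinLaw ∧
    ∫ ω, A.intervalLoss T D l ω t₀ k ∂coinLaw ≤
      (⨅ i : Fin N, ∑ t ∈ Finset.Ioc t₀ (t₀ + k), l t i) + R

end Experts

/-! ### Exponential inequalities and the constraints on one time scale -/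

namespace Experts

/-! Write `L` for `⌈log₂ (N T)⌉`. There are `J = O(log T)` time scales `τ_j = T / 4^j`, with rates
`η_j` proportional to `2^j` and normalized by `16 (D + 1) η_j² τ_j = L`. Scale `j` runs exponential
weights over the `N` experts and one further competitor, the base, which is the combination of all
longer scales. Below the longest scale the base is simply expert `0`.

One scale: log-weights start at `0`, are discounted at rate `1/τ` and clipped below at `-5L`.
Experts carry the prior factor `exp (-12 L)`, the base carries `1`. The total weight is a potential
that stays below `1 + exp (-L)` throughout (`totalWeight_stepLog_le`, `ScaleRun.totalWeight_le`):
first-order terms cancel because the mixed cost is the weighted mean, the variance is paid by the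
experts' weight alone, and the discount absorbs it for experts of large weight. So the log-weight of
the base is at most `exp (-L)` and that of an expert at most `13 L`. Telescoping the log-weights
yields regret `7L/η` against the base on every interval, and `31L/η` against every expert on
intervals of length at most `τ`.

All scales: for an interval of length `k`, take `j` with `k ≤ τ_j ≤ 4k`. Scale `j` competes with the
best expert, and each shorter scale loses `7L/η` against its base. The rates double, so these losses
form a geometric series and the total is `O(L/η_j) = O(√((D+1) k L))` (`sum_value_le`). Intervals
shorter than the shortest scale obey the trivial bound.

Switching: the weights depend on the losses only. Each node (scale, expert) receives one uniform
threshold, drawn before the first round and kept forever, and the action is the expert of the last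
node whose threshold lies below its conditional probability. This has the right marginal law. The
action can change only if some threshold is crossed, and since log-weights move by at most `3η` per
round this has probability at most `12η` times the probability of the node. Hence the expected
switching cost is dominated by a surcharge `12 D η_j` on the costs of scale `j`
(`integral_roundLoss_le`), and the regret analysis is carried out with the surcharged costs.

The remainder verifies that the program computes these quantities with `O(N J)` operations per
round. -/

lemma neg_mul_exp_le (b : ℝ) : -(b * Real.exp b) ≤ 1 - Real.exp b := by
  have h := Real.add_one_le_exp (-b)
  have h2 : Real.exp b * Real.exp (-b) = 1 := by rw [← Real.exp_add]; simp
  nlinarith [Real.exp_pos b]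

lemma sq_mul_exp_le {b : ℝ} (hb : b ≤ 0) : b ^ 2 * Real.exp b ≤ 1 - Real.exp b := by
  have h : b ^ 2 ≤ Real.exp (-b) - 1 := by
    have h3 : 1 + -b + (-b) ^ 2 / 2 + (-b) ^ 3 / 6 ≤ Real.exp (-b) := by
      have := Real.sum_le_exp_of_nonneg (neg_nonneg.2 hb) 4
      simp [Finset.sum_range_succ, Nat.factorial] at this
      linarith
    nlinarith [mul_nonneg (neg_nonneg.2 hb) (sq_nonneg (b + 3 / 2)),
      mul_nonneg (neg_nonneg.2 hb) (neg_nonneg.2 hb)]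
  have h2 : Real.exp b * Real.exp (-b) = 1 := by rw [← Real.exp_add]; simp
  nlinarith [Real.exp_pos b]

lemma exp_le_quadratic {d : ℝ} (hd : |d| ≤ 1) : Real.exp d ≤ 1 + d + d ^ 2 := by
  have := Real.abs_exp_sub_one_sub_id_le hd
  have := (abs_le.1 this).2
  linarith

lemma exp_max_le (a b : ℝ) : Real.exp (max a b) ≤ Real.exp b + Real.exp a := by
  rcases max_cases a b with h | h <;> rw [h.1] <;> linarith [Real.exp_pos a, Real.exp_pos b]

/-- Parameters of exponential weights with discounting over a time scale `τ`. -/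
structure ScaleParams (N T : ℕ) (L η τ : ℝ) : Prop where
  one_le : 1 ≤ L
  card_mul_le : (N : ℝ) * T ≤ Real.exp L
  card_pos : 1 ≤ N
  two_le : 2 ≤ T
  eta_pos : 0 < η
  eta_le : η ≤ 1 / 400
  -- Log-weights stay below `13 L`, so this makes the discount per step at most `η`.
  le_mul : 13 * L ≤ τ * η
  -- The second-order growth `8 η²` is then at most `L / (2 τ)`, which the discount outweighs once a
  -- log-weight exceeds `7 L`.
  sq_mul_le : 16 * η ^ 2 * τ ≤ L

namespace ScaleParams

variable {N T : ℕ} {L η τ : ℝ} (h : ScaleParams N T L η τ)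

include h

lemma tau_ge : 5200 * L ≤ τ := by
  have h1 := h.le_mul
  have h2 := h.eta_le
  have h3 := h.eta_pos
  have h4 := h.one_le
  have : 0 < τ := by
    by_contra hc
    nlinarith
  nlinarith

lemma tau_pos : 0 < τ := by linarith [h.tau_ge, h.one_le]

lemma time_le : (T : ℝ) ≤ Real.exp L := by
  have h1 := h.card_mul_le
  have h2 : (1 : ℝ) ≤ N := by exact_mod_cast h.card_pos
  nlinarith [(Nat.cast_nonneg T : (0 : ℝ) ≤ T)]

lemma card_le : (N : ℝ) ≤ Real.exp L := by
  have h1 := h.card_mul_le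
  have h2 : (2 : ℝ) ≤ T := by exact_mod_cast h.two_le
  nlinarith [(Nat.cast_nonneg N : (0 : ℝ) ≤ N)]

lemma two_le_exp : 2 ≤ Real.exp L := by
  have h2 : (2 : ℝ) ≤ T := by exact_mod_cast h.two_le
  linarith [h.time_le]

/-- The left side is the uncontrolled growth of the total weight in one step: experts with
log-weight below `7 L`, and the increase due to clipping at `-5 L`. It is small enough to be summed
over `T ≤ exp L` steps. -/
lemma truncation_le :
    N * (Real.exp (-12 * L) * Real.exp (7 * L)) + (1 + N * Real.exp (-12 * L)) * Real.exp (-(5 * L))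
      ≤ Real.exp (-3 * L) := by
  set u := Real.exp (-L) with hu
  have hu0 : 0 < u := Real.exp_pos _
  have huE : Real.exp L * u = 1 := by rw [hu, ← Real.exp_add]; simp
  have hNu : N * u ≤ 1 := by rw [← huE]; gcongr; exact h.card_le
  have hu2 : u ≤ 1 / 2 := by
    have := h.two_le_exp
    nlinarith
  have hpow : ∀ n : ℕ, Real.exp (-(n * L)) = u ^ n := fun n => by
    rw [hu, ← Real.exp_nat_mul]; congr 1; ring
  have p3 : Real.exp (-3 * L) = u ^ 3 := by rw [← hpow]; congr 1; push_cast; ring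
  have p5 : Real.exp (-(5 * L)) = u ^ 5 := by rw [← hpow]; congr 1
  have p12 : Real.exp (-12 * L) = u ^ 12 := by rw [← hpow]; congr 1; push_cast; ring
  have p7 : Real.exp (-12 * L) * Real.exp (7 * L) = u ^ 5 := by
    rw [← Real.exp_add, ← hpow]; congr 1; push_cast; ring
  rw [p7, p3, p5, p12]
  have a1 : N * u ^ 5 ≤ u ^ 4 := by
    calc N * u ^ 5 = (N * u) * u ^ 4 := by ring
      _ ≤ 1 * u ^ 4 := by gcongr
      _ = u ^ 4 := one_mul _
  have a2 : N * u ^ 12 ≤ 1 := by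
    calc N * u ^ 12 = (N * u) * u ^ 11 := by ring
      _ ≤ 1 * 1 := by gcongr; exact pow_le_one₀ hu0.le (by linarith)
      _ = 1 := one_mul _
  have a3 : u ^ 5 ≤ u ^ 4 / 2 := by
    calc u ^ 5 = u * u ^ 4 := by ring
      _ ≤ 1 / 2 * u ^ 4 := by gcongr
      _ = _ := by ring
  have a4 : u ^ 4 ≤ u ^ 3 / 2 := by
    calc u ^ 4 = u * u ^ 3 := by ring
      _ ≤ 1 / 2 * u ^ 3 := by gcongr
      _ = _ := by ring
  have a5 : (1 + N * u ^ 12) * u ^ 5 ≤ (1 + 1) * u ^ 5 := by gcongr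
  linarith

end ScaleParams

/-! ### The potential argument on one scale -/

/-- Total weight of the base (with log-weight `b`) and of the first `n` experts. -/
noncomputable def totalWeight (L b : ℝ) (y : ℕ → ℝ) (n : ℕ) : ℝ :=
  Real.exp b + ∑ i ∈ Finset.range n, Real.exp (-12 * L) * Real.exp (y i)

lemma totalWeight_pos (L b : ℝ) (y : ℕ → ℝ) (n : ℕ) : 0 < totalWeight L b y n := by
  unfold totalWeight
  positivity

/-- The weighted mean `c` minimizes the weighted second moment, so `c` may be replaced by `z₀`. Then
the term of the base vanishes, and the bound involves only the weight of the experts. -/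
lemma weighted_sq_dev_le {n : ℕ} (u : ℝ) (w : ℕ → ℝ) (z₀ c : ℝ) (z : ℕ → ℝ)
    (hu : 0 ≤ u) (hw : ∀ i, 0 ≤ w i)
    (hc : u * (c - z₀) + ∑ i ∈ Finset.range n, w i * (c - z i) = 0)
    (hz : ∀ i < n, |z₀ - z i| ≤ 2) :
    u * (c - z₀) ^ 2 + ∑ i ∈ Finset.range n, w i * (c - z i) ^ 2
      ≤ 4 * ∑ i ∈ Finset.range n, w i := by
  have h1 : ∑ i ∈ Finset.range n, w i * (c - z i) ^ 2 =
      ∑ i ∈ Finset.range n, w i * (z₀ - z i) ^ 2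
        + 2 * (c - z₀) * ∑ i ∈ Finset.range n, w i * (c - z i)
        - (c - z₀) ^ 2 * ∑ i ∈ Finset.range n, w i := by
    rw [Finset.mul_sum, Finset.mul_sum, ← Finset.sum_add_distrib, ← Finset.sum_sub_distrib]
    exact Finset.sum_congr rfl fun i _ => by ring
  have h2 : ∑ i ∈ Finset.range n, w i * (z₀ - z i) ^ 2 ≤ 4 * ∑ i ∈ Finset.range n, w i := by
    rw [Finset.mul_sum]
    refine Finset.sum_le_sum fun i hi => ?_
    have := hz i (Finset.mem_range.1 hi)
    have h3 : (z₀ - z i) ^ 2 ≤ 2 ^ 2 := sq_le_sq' (by linarith [(abs_le.1 this).1]) (abs_le.1 this).2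
    nlinarith [hw i]
  have h4 : 0 ≤ ∑ i ∈ Finset.range n, w i := Finset.sum_nonneg fun i _ => hw i
  have h5 : ∑ i ∈ Finset.range n, w i * (c - z i) = - (u * (c - z₀)) := by linarith
  rw [h1, h5]
  nlinarith [mul_nonneg h4 (sq_nonneg (c - z₀)), mul_nonneg hu (sq_nonneg (c - z₀))]

/-- The log-weights after a discounted, clipped exponential-weights step. -/
noncomputable def stepLog (L η τ y g : ℝ) : ℝ := max (-(5 * L)) (y - y / τ + η * g)

/-- Discounting pulls `b` towards `0`: a base of weight above `1` shrinks, and one below `1` grows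
by at most a fraction `3/τ` of its deficit. -/
lemma base_growth {b τ : ℝ} (hτ : 3 ≤ τ) (hb : 2 * b ≤ τ) :
    Real.exp b * (-(b / τ) + 2 * (b / τ) ^ 2) ≤ 3 / τ * max 0 (1 - Real.exp b) := by
  have hτ0 : 0 < τ := by linarith
  rcases le_total 0 b with h | h
  · have h1 : -(b / τ) + 2 * (b / τ) ^ 2 ≤ 0 := by
      have h2 : b / τ ≤ 1 / 2 := by rw [div_le_div_iff₀ hτ0 two_pos]; linarith
      have h3 : 0 ≤ b / τ := by positivity
      nlinarith
    have h2 : 0 ≤ 3 / τ * max 0 (1 - Real.exp b) := by positivity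
    nlinarith [Real.exp_pos b]
  · have h1 := neg_mul_exp_le b
    have h2 := sq_mul_exp_le h
    have h3 : Real.exp b * (-(b / τ) + 2 * (b / τ) ^ 2)
        = 1 / τ * (-(b * Real.exp b)) + 2 / τ ^ 2 * (b ^ 2 * Real.exp b) := by
      field_simp
    have h4 : 0 ≤ 1 - Real.exp b := by
      have := Real.exp_le_one_iff.2 h
      linarith
    rw [h3, max_eq_right h4]
    have h5 : 2 / τ ^ 2 ≤ 2 / τ := by
      apply div_le_div_of_nonneg_left <;> nlinarith
    have h6 : 1 / τ * (-(b * Real.exp b)) ≤ 1 / τ * (1 - Real.exp b) := by gcongr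
    have h7 : 2 / τ ^ 2 * (b ^ 2 * Real.exp b) ≤ 2 / τ * (1 - Real.exp b) := by
      calc _ ≤ 2 / τ ^ 2 * (1 - Real.exp b) := by gcongr
        _ ≤ _ := by gcongr
    calc _ ≤ 1 / τ * (1 - Real.exp b) + 2 / τ * (1 - Real.exp b) := add_le_add h6 h7
      _ = _ := by ring

/-- Above `7 L` the discount beats the variance term `8 η²` and the term `3/τ` inherited from the
base, so the growth is negative. Below `7 L` the weight is at most `exp (7 L)`, which the prior `exp
(-12 L)` makes negligible. -/
lemma expert_growth {L η τ y : ℝ} (hL : 1 ≤ L) (hτ : 5200 * L ≤ τ) (hη : 16 * η ^ 2 * τ ≤ L)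
    (hy : -(5 * L) ≤ y) (hy' : y ≤ 13 * L) :
    Real.exp y * (-(y / τ) + 2 * (y / τ) ^ 2 + 8 * η ^ 2 + 3 / τ) ≤ Real.exp (7 * L) := by
  have hτ0 : 0 < τ := by linarith
  have hc : 8 * η ^ 2 + 3 / τ ≤ 7 / 2 * (L / τ) := by
    have : 8 * η ^ 2 ≤ L / 2 / τ := by rw [le_div_iff₀ hτ0]; linarith
    have h2 : 3 / τ ≤ 3 * L / τ := by gcongr; linarith
    calc _ ≤ L / 2 / τ + 3 * L / τ := add_le_add this h2
      _ = _ := by ring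
  have hLτ : L / τ ≤ 1 / 5200 := by rw [div_le_div_iff₀ hτ0 (by norm_num)]; linarith
  have hyl : -(5 * (L / τ)) ≤ y / τ := by
    rw [← mul_div_assoc, ← neg_div]; gcongr
  have hyu : y / τ ≤ 13 * (L / τ) := by rw [← mul_div_assoc]; gcongr
  have hLp : 0 < L / τ := by positivity
  rcases le_total (7 * L) y with h | h
  · have h1 : 7 * (L / τ) ≤ y / τ := by rw [← mul_div_assoc]; gcongr
    have : -(y / τ) + 2 * (y / τ) ^ 2 + 8 * η ^ 2 + 3 / τ ≤ 0 := by nlinarith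
    nlinarith [Real.exp_pos y, Real.exp_pos (7 * L)]
  · have h1 : -(y / τ) + 2 * (y / τ) ^ 2 + 8 * η ^ 2 + 3 / τ ≤ 1 := by nlinarith
    calc _ ≤ Real.exp y * 1 := by gcongr
      _ ≤ _ := by rw [mul_one]; exact Real.exp_le_exp.2 h

/-- Expand each weight to second order. By `hc` the linear terms in the costs cancel. The variance
costs `8 η²` times the weight of the experts, and the remaining drift is controlled by `base_growth`
and `expert_growth`. -/
lemma totalWeight_stepLog_le {N T : ℕ} {L η τ : ℝ} (hp : ScaleParams N T L η τ) {b z₀ c : ℝ}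
    {y z : ℕ → ℝ} (hb : -(5 * L) ≤ b) (hb' : b ≤ 1) (hy : ∀ i < N, -(5 * L) ≤ y i)
    (hy' : ∀ i < N, y i ≤ 13 * L) (hz₀ : z₀ ∈ Set.Icc (0 : ℝ) 2)
    (hz : ∀ i < N, z i ∈ Set.Icc (0 : ℝ) 2) (hc2 : c ∈ Set.Icc (0 : ℝ) 2)
    (hc : Real.exp b * (c - z₀)
      + ∑ i ∈ Finset.range N, Real.exp (-12 * L) * Real.exp (y i) * (c - z i) = 0) :
    totalWeight L (stepLog L η τ b (c - z₀)) (fun i => stepLog L η τ (y i) (c - z i)) N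
      ≤ max (totalWeight L b y N) 1 + Real.exp (-3 * L) := by
  have hτ := hp.tau_ge
  have hL := hp.one_le
  have hτ0 := hp.tau_pos
  have hLτ : L / τ ≤ 1 / 5200 := by rw [div_le_div_iff₀ hτ0 (by norm_num)]; linarith
  set ε := Real.exp (-12 * L) with hε
  have hε0 : 0 < ε := Real.exp_pos _
  -- Uses `exp d ≤ 1 + d + d²` with `d = -a/τ + η (c - x)` and `d² ≤ 2 (a/τ)² + 2 η² (c - x)²`;
  -- clipping adds at most `exp (-5 L)`.
  have hstep : ∀ a x : ℝ, -(5 * L) ≤ a → a ≤ 13 * L → x ∈ Set.Icc (0 : ℝ) 2 →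
      Real.exp (stepLog L η τ a (c - x)) ≤ Real.exp a *
        (1 + (-(a / τ) + η * (c - x)) + (2 * (a / τ) ^ 2 + 2 * η ^ 2 * (c - x) ^ 2))
        + Real.exp (-(5 * L)) := by
    intro a x ha ha' hx
    refine (exp_max_le _ _).trans ?_
    gcongr
    have h1 : a - a / τ + η * (c - x) = a + (-(a / τ) + η * (c - x)) := by ring
    rw [h1, Real.exp_add]
    gcongr
    have hl : -(5 * (L / τ)) ≤ a / τ := by rw [← mul_div_assoc, ← neg_div]; gcongr
    have hu : a / τ ≤ 13 * (L / τ) := by rw [← mul_div_assoc]; gcongr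
    have hcx : |c - x| ≤ 2 := abs_le.2 ⟨by linarith [hc2.1, hx.2], by linarith [hc2.2, hx.1]⟩
    have hηc : |η * (c - x)| ≤ 1 / 200 := by
      rw [abs_mul, abs_of_pos hp.eta_pos]
      nlinarith [hp.eta_le, hp.eta_pos, abs_nonneg (c - x)]
    have hηc' := abs_le.1 hηc
    refine (exp_le_quadratic (abs_le.2 ⟨by linarith, by linarith⟩)).trans ?_
    nlinarith [sq_nonneg (a / τ + η * (c - x))]
  set w : ℕ → ℝ := fun i => ε * Real.exp (y i) with hw
  have hw0 : ∀ i, 0 ≤ w i := fun i => by positivity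
  set S := ∑ i ∈ Finset.range N, w i with hS
  have hS0 : 0 ≤ S := Finset.sum_nonneg fun i _ => hw0 i
  have hvar := weighted_sq_dev_le (n := N) (Real.exp b) w z₀ c z (Real.exp_pos b).le hw0 hc
    (fun i hi => abs_le.2 ⟨by linarith [hz₀.1, (hz i hi).2], by linarith [hz₀.2, (hz i hi).1]⟩)
  have hsum : totalWeight L (stepLog L η τ b (c - z₀)) (fun i => stepLog L η τ (y i) (c - z i)) N
      ≤ (Real.exp b + S)
        + Real.exp b * (-(b / τ) + 2 * (b / τ) ^ 2)
        + ∑ i ∈ Finset.range N, w i * (-(y i / τ) + 2 * (y i / τ) ^ 2)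
        + 2 * η ^ 2 * (Real.exp b * (c - z₀) ^ 2 + ∑ i ∈ Finset.range N, w i * (c - z i) ^ 2)
        + (1 + N * ε) * Real.exp (-(5 * L)) := by
    have e1 := hstep b z₀ hb (by linarith) hz₀
    have e2 : ∑ i ∈ Finset.range N, ε * Real.exp (stepLog L η τ (y i) (c - z i)) ≤
        ∑ i ∈ Finset.range N, (w i + w i * (-(y i / τ) + 2 * (y i / τ) ^ 2) + η * (w i * (c - z i))
          + 2 * η ^ 2 * (w i * (c - z i) ^ 2) + ε * Real.exp (-(5 * L))) := by
      refine Finset.sum_le_sum fun i hi => ?_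
      have hi := Finset.mem_range.1 hi
      have := mul_le_mul_of_nonneg_left (hstep (y i) (z i) (hy i hi) (hy' i hi) (hz i hi)) hε0.le
      refine this.trans (le_of_eq ?_)
      simp only [hw]
      ring
    simp only [Finset.sum_add_distrib, ← Finset.mul_sum, Finset.sum_const, Finset.card_range,
      nsmul_eq_mul] at e2
    have e3 : Real.exp b * (η * (c - z₀)) + η * ∑ i ∈ Finset.range N, w i * (c - z i) = 0 := by
      have : η * (Real.exp b * (c - z₀) + ∑ i ∈ Finset.range N, w i * (c - z i)) = 0 := by
        rw [hc, mul_zero]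
      linarith
    unfold totalWeight
    rw [← Finset.mul_sum]
    nlinarith
  have hbase := base_growth (b := b) (τ := τ) (by linarith) (by linarith)
  have hexp : ∀ i ∈ Finset.range N,
      w i * (-(y i / τ) + 2 * (y i / τ) ^ 2 + 8 * η ^ 2 + 3 / τ) ≤ ε * Real.exp (7 * L) := by
    intro i hi
    have hi := Finset.mem_range.1 hi
    rw [hw, mul_assoc]
    exact mul_le_mul_of_nonneg_left
      (expert_growth hL hτ hp.sq_mul_le (hy i hi) (hy' i hi)) hε0.le
  have hexp2 := Finset.sum_le_sum hexp
  rw [Finset.sum_const, Finset.card_range, nsmul_eq_mul] at hexp2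
  have hsplit : ∑ i ∈ Finset.range N, w i * (-(y i / τ) + 2 * (y i / τ) ^ 2 + 8 * η ^ 2 + 3 / τ)
      = ∑ i ∈ Finset.range N, w i * (-(y i / τ) + 2 * (y i / τ) ^ 2) + (8 * η ^ 2 + 3 / τ) * S := by
    rw [hS, Finset.mul_sum, ← Finset.sum_add_distrib]
    exact Finset.sum_congr rfl fun i _ => by ring
  -- With `S` the weight of the experts, a base that fills a fraction `3/τ ≤ 1` of its deficit
  -- pushes the total above `max (exp b + S) 1` by at most `3 S / τ`. This is charged to the
  -- experts.
  have hmax : Real.exp b + S + 3 / τ * max 0 (1 - Real.exp b) ≤ max (Real.exp b + S) 1 + 3 / τ * S := by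
    have h3 : 3 / τ ≤ 1 := by rw [div_le_one hτ0]; linarith
    have h30 : 0 < 3 / τ := by positivity
    rcases le_total 0 (1 - Real.exp b) with h | h
    · rw [max_eq_right h]
      rcases max_cases (Real.exp b + S) 1 with hm | hm <;> rw [hm.1] <;> nlinarith
    · rw [max_eq_left h]
      nlinarith [le_max_left (Real.exp b + S) 1]
  have htiny := hp.truncation_le
  rw [← hε] at htiny
  have hv2 : 2 * η ^ 2 * (Real.exp b * (c - z₀) ^ 2 + ∑ i ∈ Finset.range N, w i * (c - z i) ^ 2)
      ≤ 2 * η ^ 2 * (4 * S) := by gcongr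
  have hW : totalWeight L b y N = Real.exp b + S := rfl
  rw [hW]
  linarith


/-! ### Sequential mixing by conditional probabilities -/

/-- The probability of expert `n` among the base and the experts `0, …, n`. -/
noncomputable def nodeProb (L b : ℝ) (y : ℕ → ℝ) (n : ℕ) : ℝ :=
  Real.exp (-12 * L) * Real.exp (y n) / totalWeight L b y (n + 1)

lemma totalWeight_succ (L b : ℝ) (y : ℕ → ℝ) (n : ℕ) :
    totalWeight L b y (n + 1) = totalWeight L b y n + Real.exp (-12 * L) * Real.exp (y n) := by
  simp [totalWeight, Finset.sum_range_succ, add_assoc]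

lemma nodeProb_nonneg (L b : ℝ) (y : ℕ → ℝ) (n : ℕ) : 0 ≤ nodeProb L b y n :=
  div_nonneg (by positivity) (totalWeight_pos ..).le

lemma nodeProb_le_one (L b : ℝ) (y : ℕ → ℝ) (n : ℕ) : nodeProb L b y n ≤ 1 := by
  rw [nodeProb, div_le_one (totalWeight_pos ..), totalWeight_succ]
  linarith [totalWeight_pos L b y n]

/-- Starting from `z₀`, mix in the values `z 0, …, z (n - 1)` with the weights `q 0, …, q (n - 1)`. -/
noncomputable def mix (q z : ℕ → ℝ) (z₀ : ℝ) : ℕ → ℝ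
  | 0 => z₀
  | n + 1 => q n * z n + (1 - q n) * mix q z z₀ n

/-- Mixing node by node with conditional probabilities produces the weighted average over the base
and all experts. -/
lemma totalWeight_mul_mix (L b : ℝ) (y z : ℕ → ℝ) (z₀ : ℝ) (n : ℕ) :
    totalWeight L b y n * mix (nodeProb L b y) z z₀ n = Real.exp b * z₀ +
      ∑ i ∈ Finset.range n, Real.exp (-12 * L) * Real.exp (y i) * z i := by
  induction n with
  | zero => simp [totalWeight, mix]
  | succ n ih =>
    have h := totalWeight_pos L b y (n + 1)
    have h1 : totalWeight L b y (n + 1) * nodeProb L b y n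
        = Real.exp (-12 * L) * Real.exp (y n) := by
      rw [nodeProb]; field_simp
    rw [mix, Finset.sum_range_succ, ← add_assoc, ← ih]
    have h2 := totalWeight_succ L b y n
    calc _ = totalWeight L b y (n + 1) * nodeProb L b y n * z n + (totalWeight L b y (n + 1)
          - totalWeight L b y (n + 1) * nodeProb L b y n) * mix (nodeProb L b y) z z₀ n := by ring
      _ = _ := by rw [h1, h2]; ring

lemma mix_centered (L b : ℝ) (y z : ℕ → ℝ) (z₀ : ℝ) (n : ℕ) :
    Real.exp b * (mix (nodeProb L b y) z z₀ n - z₀) + ∑ i ∈ Finset.range n,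
      Real.exp (-12 * L) * Real.exp (y i) * (mix (nodeProb L b y) z z₀ n - z i) = 0 := by
  have h := totalWeight_mul_mix L b y z z₀ n
  simp only [mul_sub, Finset.sum_sub_distrib, ← Finset.sum_mul]
  rw [totalWeight, add_mul] at h
  linarith

lemma mix_mem {a b z₀ : ℝ} {q z : ℕ → ℝ} {n : ℕ} (hq : ∀ i, 0 ≤ q i) (hq1 : ∀ i, q i ≤ 1)
    (h₀ : z₀ ∈ Set.Icc a b) (hz : ∀ i < n, z i ∈ Set.Icc a b) : mix q z z₀ n ∈ Set.Icc a b := by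
  induction n with
  | zero => exact h₀
  | succ n ih =>
    have h1 := ih fun i hi => hz i (by omega)
    have h2 := hz n (by omega)
    have h3 := hq n
    have h4 := hq1 n
    rw [mix]
    exact (convex_Icc a b) h2 h1 h3 (by linarith) (by ring)

/-- Numerator and denominator each change by a factor within `exp (±δ)`, so the quotient changes by
a factor within `exp (±2 δ)`. The error is relative to the new probability, as charging a switch to
the newly chosen distribution requires. -/
lemma nodeProb_sub_le {L b b' δ : ℝ} {y y' : ℕ → ℝ} {n : ℕ} (hδ : 2 * δ ≤ 1)
    (hb : |b' - b| ≤ δ) (hy : ∀ i ≤ n, |y' i - y i| ≤ δ) :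
    |nodeProb L b' y' n - nodeProb L b y n| ≤ 4 * δ * nodeProb L b' y' n := by
  have hδ0 : 0 ≤ δ := (abs_nonneg _).trans hb
  have key : ∀ (b b' : ℝ) (y y' : ℕ → ℝ), |b' - b| ≤ δ → (∀ i ≤ n, |y' i - y i| ≤ δ) →
      nodeProb L b y n ≤ Real.exp (2 * δ) * nodeProb L b' y' n := by
    intro b b' y y' hb hy
    have h1 : ∀ a a' : ℝ, |a' - a| ≤ δ → Real.exp a ≤ Real.exp δ * Real.exp a' := by
      intro a a' h
      rw [← Real.exp_add]
      exact Real.exp_le_exp.2 (by linarith [(abs_le.1 h).1])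
    have h2 : totalWeight L b' y' (n + 1) ≤ Real.exp δ * totalWeight L b y (n + 1) := by
      unfold totalWeight
      rw [mul_add, Finset.mul_sum]
      refine add_le_add (h1 _ _ (by rw [abs_sub_comm]; exact hb)) (Finset.sum_le_sum fun i hi => ?_)
      have := h1 (y' i) (y i) (by rw [abs_sub_comm]; exact hy i (by simpa [Nat.lt_succ_iff] using hi))
      calc _ ≤ Real.exp (-12 * L) * (Real.exp δ * Real.exp (y i)) := by gcongr
        _ = _ := by ring
    have h3 := h1 (y n) (y' n) (hy n le_rfl)
    have hw := totalWeight_pos L b y (n + 1)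
    have hw' := totalWeight_pos L b' y' (n + 1)
    unfold nodeProb
    rw [div_le_iff₀ hw, mul_comm 2 δ, mul_two, Real.exp_add]
    calc Real.exp (-12 * L) * Real.exp (y n)
        ≤ Real.exp (-12 * L) * (Real.exp δ * Real.exp (y' n)) := by gcongr
      _ = Real.exp δ * (Real.exp (-12 * L) * Real.exp (y' n) / totalWeight L b' y' (n + 1))
          * totalWeight L b' y' (n + 1) := by field_simp
      _ ≤ Real.exp δ * (Real.exp (-12 * L) * Real.exp (y' n) / totalWeight L b' y' (n + 1))
          * (Real.exp δ * totalWeight L b y (n + 1)) := by gcongr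
      _ = _ := by ring
  have h1 := key b b' y y' hb hy
  have h2 := key b' b y' y (by rwa [abs_sub_comm]) (fun i hi => by rw [abs_sub_comm]; exact hy i hi)
  have hq := nodeProb_nonneg L b y n
  have hq' := nodeProb_nonneg L b' y' n
  have he : Real.exp (2 * δ) ≤ 1 + 4 * δ := by
    have := exp_le_quadratic (d := 2 * δ) (abs_le.2 ⟨by linarith, hδ⟩)
    nlinarith
  have he2 : Real.exp (-(2 * δ)) * Real.exp (2 * δ) = 1 := by rw [← Real.exp_add]; simp
  have he3 := Real.add_one_le_exp (-(2 * δ))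
  have h3 : Real.exp (-(2 * δ)) * nodeProb L b' y' n ≤ nodeProb L b y n := by
    calc _ ≤ Real.exp (-(2 * δ)) * (Real.exp (2 * δ) * nodeProb L b y n) := by gcongr
      _ = _ := by rw [← mul_assoc, he2, one_mul]
  rw [abs_le]
  constructor <;> nlinarith

/-! ### Regret on one time scale -/

/-- A run of `T` discounted exponential-weights steps on one time scale; `z₀ t` and `z t i` are the
costs of the base and of the experts in step `t`. -/
structure ScaleRun (N T : ℕ) (L η τ : ℝ) (b : ℕ → ℝ) (y : ℕ → ℕ → ℝ) (z₀ : ℕ → ℝ)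
    (z : ℕ → ℕ → ℝ) : Prop extends ScaleParams N T L η τ where
  base_zero : b 0 = 0
  expert_zero : ∀ i, y 0 i = 0
  base_succ : ∀ t, b (t + 1)
    = stepLog L η τ (b t) (mix (nodeProb L (b t) (y t)) (z t) (z₀ t) N - z₀ t)
  expert_succ : ∀ t i, y (t + 1) i
    = stepLog L η τ (y t i) (mix (nodeProb L (b t) (y t)) (z t) (z₀ t) N - z t i)
  base_mem : ∀ t < T, z₀ t ∈ Set.Icc (0 : ℝ) 2
  expert_mem : ∀ t < T, ∀ i < N, z t i ∈ Set.Icc (0 : ℝ) 2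

lemma log_bounds {N : ℕ} {L b : ℝ} {y : ℕ → ℝ} (h2 : 2 ≤ Real.exp L)
    (hL : 0 ≤ L) (hW : totalWeight L b y N ≤ 1 + Real.exp (-L)) :
    b ≤ Real.exp (-L) ∧ ∀ i < N, y i ≤ 13 * L := by
  unfold totalWeight at hW
  have h0 : ∀ i ∈ Finset.range N, 0 ≤ Real.exp (-12 * L) * Real.exp (y i) := fun i _ => by positivity
  constructor
  · linarith [Real.add_one_le_exp b, Finset.sum_nonneg h0]
  · intro i hi
    have h3 := Finset.single_le_sum h0 (Finset.mem_range.2 hi)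
    have h4 : Real.exp (-L) ≤ 1 := Real.exp_le_one_iff.2 (by linarith)
    have h5 : Real.exp (-12 * L + y i) ≤ Real.exp L := by
      rw [Real.exp_add]
      linarith [Real.exp_pos b]
    linarith [Real.exp_le_exp.1 h5]

namespace ScaleRun

variable {N T : ℕ} {L η τ : ℝ} {b : ℕ → ℝ} {y : ℕ → ℕ → ℝ} {z₀ : ℕ → ℝ} {z : ℕ → ℕ → ℝ}
  (h : ScaleRun N T L η τ b y z₀ z)

include h

lemma base_ge (t : ℕ) : -(5 * L) ≤ b t := by
  cases t with
  | zero => rw [h.base_zero]; linarith [h.one_le]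
  | succ t => rw [h.base_succ]; exact le_max_left ..

lemma expert_ge (t i : ℕ) : -(5 * L) ≤ y t i := by
  cases t with
  | zero => rw [h.expert_zero]; linarith [h.one_le]
  | succ t => rw [h.expert_succ]; exact le_max_left ..

lemma mix_mem {t : ℕ} (ht : t < T) :
    mix (nodeProb L (b t) (y t)) (z t) (z₀ t) N ∈ Set.Icc (0 : ℝ) 2 :=
  Experts.mix_mem (nodeProb_nonneg _ _ _) (nodeProb_le_one _ _ _) (h.base_mem t ht) (h.expert_mem t ht)

lemma add_one_mul_le {t : ℕ} (ht : t ≤ T) : ((t : ℝ) + 1) * Real.exp (-3 * L) ≤ Real.exp (-L) := by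
  have h1 := h.time_le
  have h2 := h.two_le_exp
  have h3 : (t : ℝ) ≤ T := by exact_mod_cast ht
  have h4 : Real.exp (-L) = Real.exp L * Real.exp L * Real.exp (-3 * L) := by
    rw [← Real.exp_add, ← Real.exp_add]; congr 1; ring
  rw [h4]
  gcongr
  nlinarith

/-- The bound on the total weight and the bounds on the individual log-weights are proved together:
the former implies the latter through `log_bounds`, and these are hypotheses of the next potential
step. -/
lemma totalWeight_le {t : ℕ} (ht : t ≤ T) :
    totalWeight L (b t) (y t) N ≤ 1 + ((t : ℝ) + 1) * Real.exp (-3 * L) := by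
  induction t with
  | zero =>
    have h1 := h.truncation_le
    have h2 : 1 ≤ Real.exp (7 * L) := Real.one_le_exp (by linarith [h.one_le])
    have h3 : (N : ℝ) * Real.exp (-12 * L) ≤ N * (Real.exp (-12 * L) * Real.exp (7 * L)) := by
      gcongr
      exact le_mul_of_one_le_right (Real.exp_pos _).le h2
    have h4 : 0 ≤ (1 + N * Real.exp (-12 * L)) * Real.exp (-(5 * L)) := by positivity
    simp only [totalWeight, h.base_zero, h.expert_zero, Real.exp_zero, mul_one, Finset.sum_const,
      Finset.card_range, nsmul_eq_mul, Nat.cast_zero, zero_add, one_mul]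
    linarith
  | succ t ih =>
    have ih := ih (by omega)
    have h0 := h.add_one_mul_le (t := t) (by omega)
    obtain ⟨hb, hy⟩ := log_bounds h.two_le_exp (by linarith [h.one_le]) (ih.trans (by linarith))
    have hstep := totalWeight_stepLog_le h.toScaleParams (h.base_ge t)
      (hb.trans (Real.exp_le_one_iff.2 (by linarith [h.one_le]))) (fun i _ => h.expert_ge t i) hy
      (h.base_mem t ht) (h.expert_mem t ht) (h.mix_mem ht) (mix_centered ..)
    rw [h.base_succ, show y (t + 1) = _ from funext fun i => h.expert_succ t i]
    refine hstep.trans ?_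
    have h5 : max (totalWeight L (b t) (y t) N) 1 ≤ 1 + ((t : ℝ) + 1) * Real.exp (-3 * L) :=
      max_le ih (by have : 0 ≤ ((t : ℝ) + 1) * Real.exp (-3 * L) := by positivity
                    linarith)
    push_cast
    linarith

lemma base_le {t : ℕ} (ht : t ≤ T) : b t ≤ Real.exp (-L) :=
  (log_bounds h.two_le_exp (by linarith [h.one_le])
    ((h.totalWeight_le ht).trans (by linarith [h.add_one_mul_le ht]))).1

lemma expert_le {t i : ℕ} (ht : t ≤ T) (hi : i < N) : y t i ≤ 13 * L :=
  (log_bounds h.two_le_exp (by linarith [h.one_le])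
    ((h.totalWeight_le ht).trans (by linarith [h.add_one_mul_le ht]))).2 i hi

/-- The discount contributes at most `η` and the cost difference at most `2 η`; clipping cannot
enlarge the change because `a` already lies above the clipping level. -/
lemma abs_stepLog_sub_le {t : ℕ} (ht : t < T) {a x : ℝ} (ha : -(5 * L) ≤ a) (ha' : a ≤ 13 * L)
    (hx : x ∈ Set.Icc (0 : ℝ) 2) :
    |stepLog L η τ a (mix (nodeProb L (b t) (y t)) (z t) (z₀ t) N - x) - a| ≤ 3 * η := by
  have hm := h.mix_mem ht
  set c := mix (nodeProb L (b t) (y t)) (z t) (z₀ t) N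
  have hτ := h.tau_pos
  have hη := h.eta_pos
  have hL : 13 * L / τ ≤ η := by rw [div_le_iff₀ hτ]; linarith [h.le_mul]
  have h1 : a / τ ≤ 13 * L / τ := by gcongr
  have h2 : -(13 * L / τ) ≤ a / τ := by rw [← neg_div]; gcongr; linarith [h.one_le]
  have h3 : η * (c - x) ≤ η * 2 := by gcongr; linarith [hm.2, hx.1]
  have h4 : η * (-2) ≤ η * (c - x) := by gcongr; linarith [hm.1, hx.2]
  unfold stepLog
  rw [abs_le]
  constructor
  · have := le_max_right (-(5 * L)) (a - a / τ + η * (c - x))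
    linarith
  · have : max (-(5 * L)) (a - a / τ + η * (c - x)) ≤ a + 3 * η := max_le (by linarith) (by linarith)
    linarith

lemma nodeProb_sub_le {t n : ℕ} (ht : t < T) (hn : n < N) :
    |nodeProb L (b (t + 1)) (y (t + 1)) n - nodeProb L (b t) (y t) n|
      ≤ 12 * η * nodeProb L (b (t + 1)) (y (t + 1)) n := by
  have hη := h.eta_le
  have hL := h.one_le
  have := Experts.nodeProb_sub_le (L := L) (b := b t) (b' := b (t + 1)) (y := y t) (y' := y (t + 1))
    (n := n) (δ := 3 * η) (by linarith) ?_ ?_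
  · convert this using 2; ring
  · rw [h.base_succ]
    refine h.abs_stepLog_sub_le ht (h.base_ge t) ((h.base_le ht.le).trans ?_) (h.base_mem t ht)
    have := Real.exp_le_one_iff.2 (show -L ≤ 0 by linarith)
    linarith
  · intro i hi
    rw [h.expert_succ]
    exact h.abs_stepLog_sub_le ht (h.expert_ge t i) (h.expert_le ht.le (by omega))
      (h.expert_mem t ht i (by omega))

/-- The recursion telescopes. Clipping only raises the log-weight, so it can be dropped, and the
accumulated discount is at most `k Y / τ`. -/
lemma sum_le {a g : ℕ → ℝ} {Y : ℝ} (ha : ∀ t, a (t + 1) = stepLog L η τ (a t) (g t))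
    (hl : ∀ t, -(5 * L) ≤ a t) (hu : ∀ t ≤ T, a t ≤ Y) {t₀ k : ℕ} (hk : t₀ + k ≤ T) :
    ∑ t ∈ Finset.Ico t₀ (t₀ + k), g t ≤ (Y + 5 * L + k * (Y / τ)) / η := by
  have hτ := h.tau_pos
  have hη := h.eta_pos
  have key : ∀ k, t₀ + k ≤ T →
      η * ∑ t ∈ Finset.Ico t₀ (t₀ + k), g t ≤ a (t₀ + k) - a t₀ + k * (Y / τ) := by
    intro k hk
    induction k with
    | zero => simp
    | succ k ih =>
      have ih := ih (by omega)
      rw [← add_assoc, Finset.sum_Ico_succ_top (by omega), mul_add, ha (t₀ + k), stepLog]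
      have h1 := le_max_right (-(5 * L)) (a (t₀ + k) - a (t₀ + k) / τ + η * g (t₀ + k))
      have h2 : a (t₀ + k) / τ ≤ Y / τ := by gcongr; exact hu _ (by omega)
      push_cast
      linarith
  rw [le_div_iff₀ hη]
  linarith [key k hk, hu _ hk, hl t₀]

/-- The interval may be arbitrarily long: the upper bound `exp (-L)` on the base is so small that
even `T ≤ exp L` rounds of discount contribute at most `1`. -/
lemma base_regret {t₀ k : ℕ} (hk : t₀ + k ≤ T) :
    ∑ t ∈ Finset.Ico t₀ (t₀ + k), mix (nodeProb L (b t) (y t)) (z t) (z₀ t) N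
      ≤ ∑ t ∈ Finset.Ico t₀ (t₀ + k), z₀ t + 7 * L / η := by
  have h1 := h.sum_le h.base_succ h.base_ge (fun t ht => h.base_le ht) hk
  rw [Finset.sum_sub_distrib] at h1
  have hL := h.one_le
  have h2 : Real.exp (-L) + 5 * L + k * (Real.exp (-L) / τ) ≤ 7 * L := by
    have h3 := Real.exp_le_one_iff.2 (show -L ≤ 0 by linarith)
    have h4 : k * (Real.exp (-L) / τ) ≤ 1 := by
      rw [← mul_div_assoc, div_le_one h.tau_pos]
      have h5 : (k : ℝ) ≤ Real.exp L := le_trans (by exact_mod_cast (by omega : k ≤ T)) h.time_le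
      calc (k : ℝ) * Real.exp (-L) ≤ Real.exp L * Real.exp (-L) := by gcongr
        _ = 1 := by rw [← Real.exp_add]; simp
        _ ≤ τ := by linarith [h.tau_ge]
    linarith
  have h3 : (Real.exp (-L) + 5 * L + k * (Real.exp (-L) / τ)) / η ≤ 7 * L / η := by
    have := h.eta_pos
    gcongr
  linarith

/-- The numerator is `13 L` from the top of the range, `5 L` from the clipping level and, for `k ≤
τ`, at most `13 L` of discount. -/
lemma expert_regret {t₀ k i : ℕ} (hk : t₀ + k ≤ T) (hkτ : k ≤ τ) (hi : i < N) :
    ∑ t ∈ Finset.Ico t₀ (t₀ + k), mix (nodeProb L (b t) (y t)) (z t) (z₀ t) N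
      ≤ ∑ t ∈ Finset.Ico t₀ (t₀ + k), z t i + 31 * L / η := by
  have h1 := h.sum_le (a := fun t => y t i) (fun t => h.expert_succ t i) (fun t => h.expert_ge t i)
    (fun t ht => h.expert_le ht hi) hk
  rw [Finset.sum_sub_distrib] at h1
  have hL := h.one_le
  have hη := h.eta_pos
  have hτ := h.tau_pos
  have h2 : 13 * L + 5 * L + k * (13 * L / τ) ≤ 31 * L := by
    have : k * (13 * L / τ) ≤ τ * (13 * L / τ) := by gcongr
    rw [mul_div_cancel₀ _ hτ.ne'] at this
    linarith
  have h3 : (13 * L + 5 * L + k * (13 * L / τ)) / η ≤ 31 * L / η := by gcongr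
  linarith

end ScaleRun


/-! ### The hierarchy of time scales -/

/-- `⌈log₂ (N T)⌉`. -/
noncomputable def logSize (N T : ℕ) : ℕ := Nat.clog 2 (N * T)

/-- The time scale number `j`. -/
noncomputable def timeScale (T j : ℕ) : ℝ := T / 4 ^ j

/-- The learning rate on time scale `j`. -/
noncomputable def rate (N T : ℕ) (D : ℝ) (j : ℕ) : ℝ :=
  2 ^ j * (logSize N T / (16 * T * (D + 1))) ^ (1 / 2 : ℝ)

/-- The length of the shortest time scale. -/
noncomputable def minScale (N T : ℕ) (D : ℝ) : ℝ := 10000 * logSize N T * (D + 1)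

/-- The number of time scales. -/
noncomputable def scaleCount (N T : ℕ) (D : ℝ) : ℕ := sInf {j | timeScale T j < minScale N T D}

/-- Log-weights on all scales. -/
structure Logs where
  base : ℕ → ℝ
  expert : ℕ → ℕ → ℝ

/-- The cost of expert `i` on scale `j`, including a surcharge for switching. -/
noncomputable def nodeCost (N T : ℕ) (D : ℝ) (x : ℕ → ℝ) (j i : ℕ) : ℝ :=
  x i + D * (12 * rate N T D j)

/-- The cost of the combination of the scales `0, …, j - 1`, for losses `x`. -/
noncomputable def value (N T : ℕ) (D : ℝ) (σ : Logs) (x : ℕ → ℝ) : ℕ → ℝ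
  | 0 => x 0
  | j + 1 => mix (nodeProb (logSize N T) (σ.base j) (σ.expert j)) (nodeCost N T D x j)
      (value N T D σ x j) N

/-- The new log-weights after losses `x`. -/
noncomputable def logsStep (N T : ℕ) (D : ℝ) (σ : Logs) (x : ℕ → ℝ) : Logs where
  base j := stepLog (logSize N T) (rate N T D j) (timeScale T j) (σ.base j)
    (value N T D σ x (j + 1) - value N T D σ x j)
  expert j i := stepLog (logSize N T) (rate N T D j) (timeScale T j) (σ.expert j i)
    (value N T D σ x (j + 1) - nodeCost N T D x j i)

/-- The log-weights after `t` rounds with losses `x 0, …, x (t - 1)`. -/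
noncomputable def logs (N T : ℕ) (D : ℝ) (x : ℕ → ℕ → ℝ) : ℕ → Logs
  | 0 => ⟨fun _ => 0, fun _ _ => 0⟩
  | t + 1 => logsStep N T D (logs N T D x t) (x t)

section Parameters

variable {N T : ℕ} {D : ℝ} (hN : 1 ≤ N) (hT : 2 ≤ T) (hD : 0 ≤ D)

include hN hT

lemma two_le_mul : 2 ≤ N * T := by nlinarith

lemma one_le_logSize : 1 ≤ logSize N T :=
  Nat.clog_pos one_lt_two (two_le_mul hN hT)

lemma one_le_logSize_cast : (1 : ℝ) ≤ logSize N T := by exact_mod_cast one_le_logSize hN hT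

lemma log_le_logSize : Real.log ((N : ℝ) * T) ≤ logSize N T := by
  have h1 : N * T ≤ 2 ^ logSize N T := Nat.le_pow_clog one_lt_two _
  have h2 : ((N : ℝ) * T) ≤ 2 ^ logSize N T := by exact_mod_cast h1
  have h3 : (0 : ℝ) < (N : ℝ) * T := by
    have := two_le_mul hN hT
    exact_mod_cast (by omega : 0 < N * T)
  have h4 := Real.log_le_log h3 h2
  rw [Real.log_pow] at h4
  have h5 := Real.log_two_lt_d9
  have h6 := one_le_logSize_cast hN hT
  nlinarith

lemma logSize_le : (logSize N T : ℝ) ≤ 4 * Real.log ((N : ℝ) * T) := by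
  have h0 := two_le_mul hN hT
  have h1 : 2 ^ (logSize N T - 1) < N * T := by
    apply Nat.pow_pred_clog_lt_self one_lt_two h0
  have h2 : (2 : ℝ) ^ (logSize N T - 1) ≤ (N : ℝ) * T := by exact_mod_cast h1.le
  have h4 := Real.log_le_log (by positivity) h2
  rw [Real.log_pow, Nat.cast_sub (one_le_logSize hN hT)] at h4
  have h5 := Real.log_two_gt_d9
  have h6 : (2 : ℝ) ≤ (N : ℝ) * T := by exact_mod_cast h0
  have h7 := Real.log_le_log two_pos h6
  have h8 := one_le_logSize_cast hN hT
  push_cast at h4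
  nlinarith

include hD

lemma minScale_ge : 10000 ≤ minScale N T D := by
  have := one_le_logSize_cast hN hT
  unfold minScale
  nlinarith

/-- The set whose infimum defines `scaleCount` is nonempty, so the infimum is attained and is not a
default value. It also caps the number of quartering steps by `logSize`. -/
lemma timeScale_logSize_lt : timeScale T (logSize N T) < minScale N T D := by
  have h1 : N * T ≤ 2 ^ logSize N T := Nat.le_pow_clog one_lt_two _
  have h2 : T ≤ 4 ^ logSize N T := by
    calc T ≤ N * T := Nat.le_mul_of_pos_left _ hN
      _ ≤ _ := h1
      _ ≤ _ := Nat.pow_le_pow_left (by norm_num) _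
  have h3 : timeScale T (logSize N T) ≤ 1 := by
    unfold timeScale
    rw [div_le_one (by positivity)]
    exact_mod_cast h2
  linarith [minScale_ge hN hT hD]

lemma timeScale_scaleCount_lt : timeScale T (scaleCount N T D) < minScale N T D :=
  Nat.sInf_mem (s := {j | timeScale T j < minScale N T D}) ⟨_, timeScale_logSize_lt hN hT hD⟩

lemma scaleCount_le_logSize : scaleCount N T D ≤ logSize N T :=
  Nat.sInf_le (timeScale_logSize_lt hN hT hD)

omit hN hT hD in
lemma minScale_le_timeScale {j : ℕ} (hj : j < scaleCount N T D) :
    minScale N T D ≤ timeScale T j :=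
  not_lt.1 (Nat.notMem_of_lt_sInf (s := {j | timeScale T j < minScale N T D}) hj)

lemma scaleCount_le : (scaleCount N T D : ℝ) ≤ 3 * Real.log T := by
  have hT' : (2 : ℝ) ≤ T := by exact_mod_cast hT
  have h5 := Real.log_two_gt_d9
  have h7 := Real.log_le_log two_pos hT'
  rcases Nat.eq_zero_or_pos (scaleCount N T D) with h | h
  · rw [h]; simp; linarith
  · have h1 := minScale_le_timeScale (N := N) (T := T) (D := D) (j := scaleCount N T D - 1) (by omega)
    have h2 := minScale_ge hN hT hD
    have h3 : (4 : ℝ) ^ (scaleCount N T D - 1) ≤ T := by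
      have : (1 : ℝ) ≤ timeScale T (scaleCount N T D - 1) := by linarith
      unfold timeScale at this
      rwa [one_le_div (by positivity)] at this
    have h4 := Real.log_le_log (by positivity) h3
    rw [Real.log_pow, Nat.cast_sub h] at h4
    have h8 : Real.log 4 = 2 * Real.log 2 := by
      rw [show (4 : ℝ) = 2 ^ 2 by norm_num, Real.log_pow]; norm_num
    have h9 : (1 : ℝ) ≤ scaleCount N T D := by exact_mod_cast h
    rw [h8] at h4
    push_cast at h4
    nlinarith

lemma rate_pos (j : ℕ) : 0 < rate N T D j := by
  have := one_le_logSize hN hT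
  have : (0 : ℝ) < logSize N T := by exact_mod_cast this
  have : (0 : ℝ) < T := by exact_mod_cast (by omega : 0 < T)
  unfold rate
  positivity

omit hN in
-- The normalization that balances the regret `L/η` against the switching surcharge `D η τ`.
lemma rate_sq_mul (j : ℕ) :
    rate N T D j ^ 2 * timeScale T j * (16 * (D + 1)) = logSize N T := by
  have h0 : (0 : ℝ) < T := by exact_mod_cast (by omega : 0 < T)
  have h1 : (0 : ℝ) ≤ logSize N T / (16 * T * (D + 1)) := by positivity
  unfold rate timeScale
  rw [← Real.sqrt_eq_rpow, mul_pow, Real.sq_sqrt h1, ← pow_mul, mul_comm j 2, pow_mul]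
  norm_num
  field_simp

omit hN hT hD in
lemma rate_succ (j : ℕ) : rate N T D (j + 1) = 2 * rate N T D j := by
  unfold rate
  ring

/-- Where the constant of `minScale` comes from: `(η (D+1))² = L (D+1) / (16 τ) ≤ 1 / 160000`. In
particular the surcharge `12 D η` is below `1`, so surcharged costs lie in `[0,2]`. -/
lemma rate_mul_le {j : ℕ} (hj : j < scaleCount N T D) : rate N T D j * (D + 1) ≤ 1 / 400 := by
  have h1 := minScale_le_timeScale hj
  have h2 := rate_sq_mul (N := N) hT hD j
  have h3 := rate_pos hN hT hD j
  have h4 := minScale_ge hN hT hD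
  unfold minScale at h1
  have h6 := one_le_logSize_cast hN hT
  have hτ : 0 < timeScale T j := by unfold minScale at h4; linarith
  have h5 : (rate N T D j * (D + 1)) ^ 2 ≤ (1 / 400) ^ 2 := by
    have : (rate N T D j * (D + 1)) ^ 2 * (16 * timeScale T j) ≤
        (1 / 400) ^ 2 * (16 * timeScale T j) := by
      calc _ = (rate N T D j ^ 2 * timeScale T j * (16 * (D + 1))) * (D + 1) := by ring
        _ = logSize N T * (D + 1) := by rw [h2]
        _ ≤ _ := by linarith
    exact le_of_mul_le_mul_right this (by positivity)
  exact le_of_sq_le_sq h5 (by norm_num)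

lemma scaleParams {j : ℕ} (hj : j < scaleCount N T D) :
    ScaleParams N T (logSize N T) (rate N T D j) (timeScale T j) := by
  have h1 := minScale_le_timeScale hj
  have h2 := rate_sq_mul (N := N) hT hD j
  have h3 := rate_pos hN hT hD j
  have h4 := minScale_ge hN hT hD
  have h6 := one_le_logSize_cast hN hT
  have h7 := rate_mul_le hN hT hD hj
  have hτ : 0 < timeScale T j := by linarith
  have hNT : (0 : ℝ) < (N : ℝ) * T := by exact_mod_cast (by nlinarith : 0 < N * T)
  refine ⟨h6, ?_, hN, hT, h3, ?_, ?_, ?_⟩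
  · rw [← Real.log_le_iff_le_exp hNT]
    exact log_le_logSize hN hT
  · nlinarith
  · refine le_of_sq_le_sq ?_ (by positivity)
    unfold minScale at h1
    have : (13 * (logSize N T : ℝ)) ^ 2 * (16 * (D + 1)) ≤
        (timeScale T j * rate N T D j) ^ 2 * (16 * (D + 1)) := by
      calc (13 * (logSize N T : ℝ)) ^ 2 * (16 * (D + 1))
          = 2704 * (logSize N T * (D + 1)) * logSize N T := by ring
        _ ≤ timeScale T j * logSize N T := by
          gcongr
          nlinarith
        _ = timeScale T j * (rate N T D j ^ 2 * timeScale T j * (16 * (D + 1))) := by rw [h2]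
        _ = _ := by ring
    exact le_of_mul_le_mul_right this (by positivity)
  · have : 0 ≤ rate N T D j ^ 2 * timeScale T j * D := by positivity
    nlinarith

lemma nodeCost_mem {x : ℕ → ℝ} (hx : ∀ i < N, x i ∈ Set.Icc (0 : ℝ) 1) {j i : ℕ}
    (hj : j < scaleCount N T D) (hi : i < N) : nodeCost N T D x j i ∈ Set.Icc (0 : ℝ) 2 := by
  have h1 := rate_mul_le hN hT hD hj
  have h2 := rate_pos hN hT hD j
  have h3 := hx i hi
  have h4 : 0 ≤ D * (12 * rate N T D j) := by positivity
  unfold nodeCost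
  constructor
  · linarith [h3.1]
  · nlinarith [h3.2]

lemma value_mem {x : ℕ → ℝ} (hx : ∀ i < N, x i ∈ Set.Icc (0 : ℝ) 1) (σ : Logs) {j : ℕ}
    (hj : j ≤ scaleCount N T D) : value N T D σ x j ∈ Set.Icc (0 : ℝ) 2 := by
  induction j with
  | zero =>
    have := hx 0 hN
    exact ⟨this.1, this.2.trans one_le_two⟩
  | succ j ih =>
    exact mix_mem (nodeProb_nonneg _ _ _) (nodeProb_le_one _ _ _) (ih (by omega))
      fun _ hi => nodeCost_mem hN hT hD hx hj hi

variable {x : ℕ → ℕ → ℝ} (hx : ∀ t < T, ∀ i < N, x t i ∈ Set.Icc (0 : ℝ) 1)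

include hx

lemma scaleRun {j : ℕ} (hj : j < scaleCount N T D) :
    ScaleRun N T (logSize N T) (rate N T D j) (timeScale T j)
      (fun t => (logs N T D x t).base j) (fun t => (logs N T D x t).expert j)
      (fun t => value N T D (logs N T D x t) (x t) j)
      (fun t => nodeCost N T D (x t) j) where
  toScaleParams := scaleParams hN hT hD hj
  base_zero := rfl
  expert_zero _ := rfl
  base_succ _ := rfl
  expert_succ _ _ := rfl
  base_mem t ht := value_mem hN hT hD (hx t ht) _ hj.le
  expert_mem t ht _ hi := nodeCost_mem hN hT hD (hx t ht) hj hi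

/-- Each further scale loses `7 L / η` against its base; with doubling rates this telescopes as a
difference of the terms `14 L / η`. -/
lemma sum_value_le_of_le {t₀ k j : ℕ} (hk : t₀ + k ≤ T) (m : ℕ) (hm : j + m ≤ scaleCount N T D) :
    ∑ t ∈ Finset.Ico t₀ (t₀ + k), value N T D (logs N T D x t) (x t) (j + m) ≤
      ∑ t ∈ Finset.Ico t₀ (t₀ + k), value N T D (logs N T D x t) (x t) j
        + 14 * logSize N T * (1 / rate N T D j - 1 / rate N T D (j + m)) := by
  induction m with
  | zero => simp
  | succ m ih =>
    have h1 := (scaleRun hN hT hD hx (j := j + m) (by omega)).base_regret hk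
    have h2 := ih (by omega)
    have h4 : (1 : ℝ) / rate N T D (j + m) = 2 * (1 / rate N T D (j + (m + 1))) := by
      rw [← add_assoc, rate_succ]
      have := rate_pos hN hT hD (j + m)
      field_simp
    have h5 : 7 * (logSize N T : ℝ) / rate N T D (j + m)
        = 14 * logSize N T * (1 / rate N T D (j + m) - 1 / rate N T D (j + (m + 1))) := by
      rw [div_eq_mul_one_div, h4]; ring
    rw [h5] at h1
    refine h1.trans ((add_le_add_left h2 _).trans (le_of_eq ?_))
    ring

lemma sum_value_le_card {t₀ k : ℕ} (hk : t₀ + k ≤ T) :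
    ∑ t ∈ Finset.Ico t₀ (t₀ + k), value N T D (logs N T D x t) (x t) (scaleCount N T D)
      ≤ 2 * k := by
  refine (Finset.sum_le_card_nsmul _ _ 2 fun t ht => ?_).trans (le_of_eq ?_)
  · have := Finset.mem_Ico.1 ht
    exact (value_mem hN hT hD (hx t (by omega)) _ le_rfl).2
  · simp [mul_comm]

/-- The regret of the combination of all scales on an interval. -/
lemma sum_value_le {t₀ k i : ℕ} (hk : t₀ + k ≤ T) (hi : i < N) :
    ∑ t ∈ Finset.Ico t₀ (t₀ + k), value N T D (logs N T D x t) (x t) (scaleCount N T D)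
      ≤ ∑ t ∈ Finset.Ico t₀ (t₀ + k), x t i
        + 1000 * Real.sqrt ((D + 1) * k * Real.log ((N : ℝ) * T)) := by
  set R := Real.sqrt ((D + 1) * k * Real.log ((N : ℝ) * T)) with hR
  have hR0 : 0 ≤ R := Real.sqrt_nonneg _
  have hlog := logSize_le hN hT
  have hL1 := one_le_logSize_cast hN hT
  have hk0 : (0 : ℝ) ≤ k := Nat.cast_nonneg k
  have hR2 : (D + 1) * k * logSize N T ≤ 4 * R ^ 2 := by
    rw [hR, Real.sq_sqrt (by have : 0 ≤ Real.log ((N : ℝ) * T) := by linarith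
                             positivity)]
    calc _ ≤ (D + 1) * k * (4 * Real.log ((N : ℝ) * T)) := by gcongr
      _ = _ := by ring
  -- Short intervals: the costs total at most `2 k`, and `k ≤ minScale` gives `k² ≤ 40000 R²`. This
  -- also covers the case of no scales at all.
  rcases le_or_gt (k : ℝ) (minScale N T D) with hsmall | hlarge
  · have h1 := sum_value_le_card hN hT hD hx hk
    have h2 : 0 ≤ ∑ t ∈ Finset.Ico t₀ (t₀ + k), x t i := Finset.sum_nonneg fun t ht => by
      have := Finset.mem_Ico.1 ht
      exact (hx t (by omega) i hi).1
    have h3 : (k : ℝ) ≤ 200 * R := by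
      refine le_of_sq_le_sq ?_ (by positivity)
      unfold minScale at hsmall
      nlinarith
    linarith
  -- The scales start at `T ≥ k`, end below `k`, and shrink by factors of `4`; take the last one
  -- that is still at least `k`.
  · have hex : ∃ j < scaleCount N T D, (k : ℝ) ≤ timeScale T j ∧ timeScale T j ≤ 4 * k := by
      have hlast := timeScale_scaleCount_lt hN hT hD
      have h0 : (k : ℝ) ≤ timeScale T 0 := by
        simp only [timeScale, pow_zero, div_one]
        exact_mod_cast (by omega : k ≤ T)
      by_contra! hno
      have : ∀ j ≤ scaleCount N T D, (k : ℝ) ≤ timeScale T j := by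
        intro j hj
        induction j with
        | zero => exact h0
        | succ j ih =>
          have h1 := hno j (by omega) (ih (by omega))
          have h2 : timeScale T j = 4 * timeScale T (j + 1) := by
            unfold timeScale
            field_simp
            ring
          linarith
      linarith [this _ le_rfl]
    obtain ⟨j, hj, hkj, hjk⟩ := hex
    have hrun := scaleRun hN hT hD hx hj
    have h1 : ∑ t ∈ Finset.Ico t₀ (t₀ + k), value N T D (logs N T D x t) (x t) (j + 1) ≤
        ∑ t ∈ Finset.Ico t₀ (t₀ + k), nodeCost N T D (x t) j i
          + 31 * logSize N T / rate N T D j := hrun.expert_regret hk hkj hi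
    have h2 := sum_value_le_of_le hN hT hD hx (j := j + 1) hk (scaleCount N T D - (j + 1)) (by omega)
    rw [Nat.add_sub_cancel' (by omega : j + 1 ≤ scaleCount N T D)] at h2
    have hη := rate_pos hN hT hD j
    have hηJ := rate_pos hN hT hD (scaleCount N T D)
    have hsq := rate_sq_mul (N := N) hT hD j
    have hτ := (scaleParams hN hT hD hj).tau_pos
    have h3 : logSize N T / rate N T D j ≤ 16 * R := by
      refine le_of_sq_le_sq ?_ (by positivity)
      rw [div_pow, div_le_iff₀ (by positivity)]
      have : (logSize N T : ℝ) ^ 2 * (timeScale T j * (16 * (D + 1))) ≤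
          (16 * R) ^ 2 * rate N T D j ^ 2 * (timeScale T j * (16 * (D + 1))) := by
        calc _ = 16 * ((D + 1) * timeScale T j * logSize N T) * logSize N T := by ring
          _ ≤ 16 * ((D + 1) * (4 * k) * logSize N T) * logSize N T := by gcongr
          _ = 64 * ((D + 1) * k * logSize N T) * logSize N T := by ring
          _ ≤ 64 * (4 * R ^ 2) * logSize N T := by gcongr
          _ = (16 * R) ^ 2 * logSize N T := by ring
          _ = (16 * R) ^ 2 * (rate N T D j ^ 2 * timeScale T j * (16 * (D + 1))) := by rw [hsq]
          _ = _ := by ring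
      exact le_of_mul_le_mul_right this (by positivity)
    have h4 : D * (12 * rate N T D j) * k ≤ 12 * R := by
      have h5 : (D + 1) * rate N T D j * k ≤ R := by
        refine le_of_sq_le_sq ?_ hR0
        calc ((D + 1) * rate N T D j * k) ^ 2
            = ((D + 1) * k * (rate N T D j ^ 2 * k * (16 * (D + 1)))) / 16 := by ring
          _ ≤ ((D + 1) * k * (rate N T D j ^ 2 * timeScale T j * (16 * (D + 1)))) / 16 := by gcongr
          _ = ((D + 1) * k * logSize N T) / 16 := by rw [hsq]
          _ ≤ R ^ 2 := by nlinarith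
      have h6 : 0 ≤ rate N T D j * k := by positivity
      nlinarith
    have h5 : ∑ t ∈ Finset.Ico t₀ (t₀ + k), nodeCost N T D (x t) j i
        = ∑ t ∈ Finset.Ico t₀ (t₀ + k), x t i + D * (12 * rate N T D j) * k := by
      simp [nodeCost, Finset.sum_add_distrib]
      ring
    -- The whole geometric tail of shorter scales costs at most as much as one term `7 L / η_j`.
    have h6 : 14 * (logSize N T : ℝ) * (1 / rate N T D (j + 1) - 1 / rate N T D (scaleCount N T D))
        ≤ 7 * (logSize N T / rate N T D j) := by
      have h7 : 0 ≤ 14 * (logSize N T : ℝ) * (1 / rate N T D (scaleCount N T D)) := by positivity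
      have h8 : 14 * (logSize N T : ℝ) * (1 / rate N T D (j + 1))
          = 7 * (logSize N T / rate N T D j) := by
        rw [rate_succ]; field_simp; norm_num
      rw [mul_sub, h8]
      linarith
    rw [mul_div_assoc] at h1
    linarith

end Parameters


/-! ### Fixed thresholds: marginal law and switching cost -/

section Coins

open MeasureTheory ProbabilityTheory

/-- The label of the last node `m < n` whose threshold lies below its probability, else `0`. -/
noncomputable def chainAction (q : ℕ → ℝ) (e : ℕ → ℕ) (ω : ℕ → unitInterval) : ℕ → ℕ
  | 0 => 0
  | n + 1 => if (ω n : ℝ) < q n then e n else chainAction q e ω n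

lemma chainAction_lt {q : ℕ → ℝ} {e : ℕ → ℕ} {ω : ℕ → unitInterval} {N : ℕ} (hN : 1 ≤ N)
    (he : ∀ n, e n < N) (n : ℕ) : chainAction q e ω n < N := by
  induction n with
  | zero => exact hN
  | succ n ih =>
    rw [chainAction]
    split_ifs
    · exact he n
    · exact ih

lemma measurable_chainAction (q : ℕ → ℝ) (e : ℕ → ℕ) (n : ℕ) :
    Measurable (fun ω => chainAction q e ω n) := by
  induction n with
  | zero => exact measurable_const
  | succ n ih =>
    simp only [chainAction]
    refine Measurable.ite ?_ measurable_const ih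
    exact measurableSet_lt (by fun_prop) measurable_const

lemma chainAction_congr {q : ℕ → ℝ} {e : ℕ → ℕ} {ω ω' : ℕ → unitInterval} {n : ℕ}
    (h : ∀ m < n, ω m = ω' m) : chainAction q e ω n = chainAction q e ω' n := by
  induction n with
  | zero => rfl
  | succ n ih => rw [chainAction, chainAction, h n (by omega), ih fun m hm => h m (by omega)]

instance : IsProbabilityMeasure coinLaw := by
  unfold coinLaw
  infer_instance

lemma iIndepFun_coins : iIndepFun (fun (i : ℕ) (ω : ℕ → unitInterval) => ω i) coinLaw :=
  iIndepFun_infinitePi (P := fun _ : ℕ => (volume : Measure unitInterval))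
    (X := fun _ => id) (fun _ => measurable_id)

/-- Extension of a finite sequence of coins by zeros. -/
noncomputable def extendCoins (n : ℕ) (r : Finset.range n → unitInterval) : ℕ → unitInterval :=
  fun i => if h : i ∈ Finset.range n then r ⟨i, h⟩ else 0

/-- Coin `n` is independent of the finitely many earlier ones. A function of the prefix is rewritten
through `extendCoins` so that independence of finite blocks of coordinates applies. -/
lemma integral_mul_prefix {n : ℕ} {g : unitInterval → ℝ} {f : (ℕ → unitInterval) → ℝ}
    (hg : Measurable g) (hf : Measurable f)
    (hdep : ∀ ω ω' : ℕ → unitInterval, (∀ m < n, ω m = ω' m) → f ω = f ω') :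
    ∫ ω, g (ω n) * f ω ∂coinLaw = (∫ u, g u) * ∫ ω, f ω ∂coinLaw := by
  have h1 := iIndepFun_coins.indepFun_finset {n} (Finset.range n) (by simp)
    (fun i => measurable_pi_apply i)
  have hE : Measurable (extendCoins n) := by
    refine measurable_pi_lambda _ fun i => ?_
    unfold extendCoins
    split_ifs
    · exact measurable_pi_apply _
    · exact measurable_const
  have hφ : Measurable fun r : (({n} : Finset ℕ) → unitInterval) =>
      g (r ⟨n, Finset.mem_singleton_self n⟩) := hg.comp (measurable_pi_apply _)
  have h2 := h1.comp hφ (hf.comp hE)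
  have h3 : ∀ ω : ℕ → unitInterval, f (extendCoins n fun i => ω i) = f ω := fun ω =>
    hdep _ _ fun m hm => by simp [extendCoins, hm]
  have h4 := h2.integral_fun_mul_eq_mul_integral
    (hg.comp (measurable_pi_apply n)).aestronglyMeasurable
    (by simp only [Function.comp_def, h3]; exact hf.aestronglyMeasurable)
  simp only [Function.comp_def, h3] at h4
  rw [h4]
  congr 1
  have h5 : MeasurePreserving (Function.eval n) coinLaw (volume : Measure unitInterval) :=
    measurePreserving_eval_infinitePi (fun _ : ℕ => (volume : Measure unitInterval)) n
  rw [← h5.map_eq, integral_map h5.measurable.aemeasurable hg.aestronglyMeasurable]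

open Classical in
lemma integral_indicator_lt {a : ℝ} (h0 : 0 ≤ a) (h1 : a ≤ 1) :
    ∫ u : unitInterval, (if (u : ℝ) < a then (1 : ℝ) else 0) = a := by
  have h : (fun u : unitInterval => if (u : ℝ) < a then (1 : ℝ) else 0)
      = Set.indicator (Set.Iio ⟨a, h0, h1⟩) 1 := by
    ext u
    simp only [Set.indicator, Set.mem_Iio, Pi.one_apply]
    rfl
  rw [h, integral_indicator_one measurableSet_Iio, measureReal_def, unitInterval.volume_Iio]
  simp [h0]

lemma integrable_of_le {f : (ℕ → unitInterval) → ℝ} (hf : Measurable f) {B : ℝ}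
    (hB : ∀ ω, |f ω| ≤ B) : Integrable f coinLaw :=
  Integrable.of_bound hf.aestronglyMeasurable B (Filter.Eventually.of_forall hB)

open Classical in
/-- Loss plus switching cost for consecutive actions `a` and `b`. -/
noncomputable def roundLoss (D : ℝ) (x : ℕ → ℝ) (a b : ℕ) : ℝ :=
  x b + D * (if b ≠ a then (1 : ℝ) else 0)

lemma measurable_roundLoss (D : ℝ) (x : ℕ → ℝ) (q q' : ℕ → ℝ) (e : ℕ → ℕ) (n : ℕ) :
    Measurable fun ω => roundLoss D x (chainAction q e ω n) (chainAction q' e ω n) :=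
  (measurable_from_prod_countable_left (f := fun p : ℕ × ℕ => roundLoss D x p.1 p.2)
    fun _ => measurable_from_top).comp
    ((measurable_chainAction q e n).prodMk (measurable_chainAction q' e n))

lemma abs_roundLoss_le {D : ℝ} (hD : 0 ≤ D) {x : ℕ → ℝ} (hx : ∀ i, |x i| ≤ 1) (a b : ℕ) :
    |roundLoss D x a b| ≤ 1 + D := by
  unfold roundLoss
  refine (abs_add_le _ _).trans (add_le_add (hx b) ?_)
  split_ifs <;> simp [abs_of_nonneg hD, hD]

lemma integrable_roundLoss {D : ℝ} (hD : 0 ≤ D) {x : ℕ → ℝ} (hx : ∀ i, |x i| ≤ 1)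
    (q q' : ℕ → ℝ) (e : ℕ → ℕ) (n : ℕ) :
    Integrable (fun ω => roundLoss D x (chainAction q e ω n) (chainAction q' e ω n)) coinLaw :=
  integrable_of_le (measurable_roundLoss ..) fun _ => abs_roundLoss_le hD hx _ _

/-- The expected loss including the cost of switching. -/
lemma integral_roundLoss_le {D : ℝ} (hD : 0 ≤ D) {x : ℕ → ℝ} (hx : ∀ i, |x i| ≤ 1)
    {q q' κ : ℕ → ℝ} (e : ℕ → ℕ) {n : ℕ} (hq : ∀ m, 0 ≤ q m ∧ q m ≤ 1)
    (hq' : ∀ m, 0 ≤ q' m ∧ q' m ≤ 1) (hκ : ∀ m < n, |q' m - q m| ≤ κ m * q' m) :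
    ∫ ω, roundLoss D x (chainAction q e ω n) (chainAction q' e ω n) ∂coinLaw
      ≤ mix q' (fun m => x (e m) + D * κ m) (x 0) n := by
  classical
  induction n with
  | zero => simp [chainAction, roundLoss, mix]
  | succ n ih =>
    have ih := ih fun m hm => hκ m (by omega)
    set F : (ℕ → unitInterval) → ℝ :=
      fun ω => roundLoss D x (chainAction q e ω n) (chainAction q' e ω n) with hF
    have hFm : Measurable F := measurable_roundLoss ..
    have hFi : Integrable F coinLaw := integrable_roundLoss hD hx ..
    -- The decision of node `n` as a function of its threshold; its mean is the probability of the
    -- node.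
    let ind : ℝ → unitInterval → ℝ := fun a u => if (u : ℝ) < a then (1 : ℝ) else 0
    have hind : ∀ a, Measurable (ind a) := fun a =>
      Measurable.ite (measurableSet_lt (by fun_prop) measurable_const)
        measurable_const measurable_const
    have hind1 : ∀ a u, |ind a u| ≤ 1 := fun a u => by
      simp only [ind]; split_ifs <;> simp
    have hint : ∀ a, Integrable (fun ω : ℕ → unitInterval => ind a (ω n)) coinLaw := fun a =>
      integrable_of_le ((hind a).comp (measurable_pi_apply n)) fun ω => hind1 a (ω n)
    have hval : ∀ a, 0 ≤ a → a ≤ 1 → ∫ ω : ℕ → unitInterval, ind a (ω n) ∂coinLaw = a := by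
      intro a h0 h1
      have h2 := integral_mul_prefix (n := n) (f := fun _ => 1) (hind a) measurable_const
        (fun _ _ _ => rfl)
      simp only [mul_one, integral_const, smul_eq_mul, probReal_univ] at h2
      rw [h2]
      exact integral_indicator_lt h0 h1
    obtain ⟨a, ha⟩ : ∃ a, a = q n := ⟨_, rfl⟩
    obtain ⟨b, hb⟩ : ∃ b, b = q' n := ⟨_, rfl⟩
    have ha01 := hq n
    have hb01 := hq' n
    have hab := hκ n (by omega)
    rw [← ha] at ha01 hab
    rw [← hb] at hb01 hab
    have hmul : ∫ ω, ind b (ω n) * F ω ∂coinLaw = b * ∫ ω, F ω ∂coinLaw := by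
      rw [integral_mul_prefix (hind b) hFm, show ∫ u, ind b u = b from
        integral_indicator_lt hb01.1 hb01.2]
      intro ω ω' h
      simp only [hF]
      rw [chainAction_congr h, chainAction_congr h]
    have hmuli : Integrable (fun ω => ind b (ω n) * F ω) coinLaw := by
      refine hFi.bdd_mul (c := 1) ((hind b).comp (measurable_pi_apply n)).aestronglyMeasurable ?_
      exact Filter.Eventually.of_forall fun ω => hind1 b (ω n)
    -- If node `n` decides alike in both rounds, either the action is `e n` twice or the earlier
    -- nodes decide, with cost `F`. If the threshold lies between the two probabilities, an
    -- additional `D` covers any switch; this event has probability `|b - a|`.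
    have hpt : ∀ ω, roundLoss D x (chainAction q e ω (n + 1)) (chainAction q' e ω (n + 1)) ≤
        ind b (ω n) * x (e n) + (F ω - ind b (ω n) * F ω)
          + D * (ind (max a b) (ω n) - ind (min a b) (ω n)) := by
      intro ω
      simp only [chainAction, ind, hF, lt_max_iff, lt_min_iff, ← ha, ← hb]
      have hle : ∀ c d, roundLoss D x c d ≤ x d + D := fun c d => by
        unfold roundLoss; split_ifs <;> linarith
      have hge : ∀ c d, x d ≤ roundLoss D x c d := fun c d => by
        unfold roundLoss; split_ifs <;> linarith
      by_cases h1 : (ω n : ℝ) < a <;> by_cases h2 : (ω n : ℝ) < b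
      · simp [h1, h2, roundLoss]
      · simp only [h1, h2, if_true, if_false, true_or, and_false]
        linarith [hle (e n) (chainAction q' e ω n),
          hge (chainAction q e ω n) (chainAction q' e ω n)]
      · simp only [h1, h2, if_true, if_false, or_true, false_and]
        linarith [hle (chainAction q e ω n) (e n)]
      · simp [h1, h2]
    have hI1 : Integrable (fun ω : ℕ → unitInterval => ind b (ω n) * x (e n)) coinLaw :=
      (hint b).mul_const _
    have hI2 : Integrable (fun ω => F ω - ind b (ω n) * F ω) coinLaw := hFi.sub hmuli
    have hI3 : Integrable (fun ω : ℕ → unitInterval =>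
        D * (ind (max a b) (ω n) - ind (min a b) (ω n))) coinLaw :=
      ((hint _).sub (hint _)).const_mul _
    have hI12 : Integrable (fun ω => ind b (ω n) * x (e n) + (F ω - ind b (ω n) * F ω)) coinLaw :=
      hI1.add hI2
    refine (integral_mono (integrable_roundLoss hD hx ..) (hI12.add hI3) hpt).trans ?_
    have hsum : ∫ ω, (ind b (ω n) * x (e n) + (F ω - ind b (ω n) * F ω)
          + D * (ind (max a b) (ω n) - ind (min a b) (ω n))) ∂coinLaw
        = b * x (e n) + (∫ ω, F ω ∂coinLaw - b * ∫ ω, F ω ∂coinLaw) + D * |b - a| := by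
      rw [integral_add hI12 hI3, integral_add hI1 hI2, integral_sub hFi hmuli, hmul,
        integral_mul_const, integral_const_mul, integral_sub (hint _) (hint _),
        hval b hb01.1 hb01.2, hval _ (le_max_of_le_left ha01.1) (max_le ha01.2 hb01.2),
        hval _ (le_min ha01.1 hb01.1) ((min_le_left _ _).trans ha01.2), max_sub_min_eq_abs]
    refine hsum.le.trans ?_
    rw [mix, ← hb]
    have h1 : (1 - b) * ∫ ω, F ω ∂coinLaw
        ≤ (1 - b) * mix q' (fun m => x (e m) + D * κ m) (x 0) n :=
      mul_le_mul_of_nonneg_left ih (by linarith [hb01.2])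
    have h2 : D * |b - a| ≤ D * (κ n * b) := by gcongr
    linarith


end Coins

/-! ### Program logic for the machine -/

/-- The integer registers that a program may write. -/
def Cmd.natWrites : Cmd → List ℕ
  | .skip => []
  | .setNat x _ => [x]
  | .setReal _ _ _ => []
  | .sample _ _ => []
  | .seq c d => c.natWrites ++ d.natWrites
  | .ite _ c d => c.natWrites ++ d.natWrites
  | .loop _ _ c => c.natWrites

/-- The arrays that a program may write. -/
def Cmd.realWrites : Cmd → List ℕ
  | .skip => []
  | .setNat _ _ => []
  | .setReal a _ _ => [a]
  | .sample a _ => [a]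
  | .seq c d => c.realWrites ++ d.realWrites
  | .ite _ c d => c.realWrites ++ d.realWrites
  | .loop _ _ c => c.realWrites

/-- Programs without loops. -/
def Cmd.loopFree : Cmd → Bool
  | .seq c d => c.loopFree && d.loopFree
  | .ite _ c d => c.loopFree && d.loopFree
  | .loop _ _ _ => false
  | _ => true

/-- An upper bound for the number of steps of a program without loops. -/
def Cmd.stepBound : Cmd → ℕ
  | .skip => 1
  | .setNat _ e => e.cost + 1
  | .setReal _ e f => e.cost + f.cost + 1
  | .sample _ e => e.cost + 1
  | .seq c d => c.stepBound + d.stepBound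
  | .ite b c d => b.cost + 1 + max c.stepBound d.stepBound
  | .loop _ _ _ => 0

/-- `s'` agrees with `s` in everything that `c` does not write. -/
def Frame (c : Cmd) (s s' : State) : Prop :=
  (∀ x, x ∉ c.natWrites → s'.nat x = s.nat x) ∧ (∀ a, a ∉ c.realWrites → s'.real a = s.real a)

lemma Frame.refl (c : Cmd) (s : State) : Frame c s s := ⟨fun _ _ => rfl, fun _ _ => rfl⟩

lemma Frame.trans {c : Cmd} {s s' s'' : State} (h : Frame c s s') (h' : Frame c s' s'') :
    Frame c s s'' :=
  ⟨fun x hx => (h'.1 x hx).trans (h.1 x hx), fun a ha => (h'.2 a ha).trans (h.2 a ha)⟩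

lemma iter_frame {c : Cmd} {b : Test} {f : State → State × ℕ} (hf : ∀ s, Frame c s (f s).1) (n : ℕ)
    (s : State) : Frame c s (iter b f n s).1 := by
  induction n generalizing s with
  | zero => exact Frame.refl c s
  | succ n ih =>
    rw [iter]
    split_ifs
    · exact (hf s).trans (ih _)
    · exact Frame.refl c s

lemma exec_frame (ω : ℕ → unitInterval) (c : Cmd) (s : State) : Frame c s (exec ω c s).1 := by
  induction c generalizing s with
  | skip => exact Frame.refl _ s
  | setNat x e =>
    refine ⟨fun y hy => ?_, fun _ _ => rfl⟩
    simp only [Cmd.natWrites, List.mem_singleton] at hy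
    simp [exec, State.setNat, hy]
  | setReal a e f =>
    refine ⟨fun _ _ => rfl, fun y hy => ?_⟩
    simp only [Cmd.realWrites, List.mem_singleton] at hy
    simp [exec, State.setReal, hy]
  | sample a e =>
    refine ⟨fun _ _ => rfl, fun y hy => ?_⟩
    simp only [Cmd.realWrites, List.mem_singleton] at hy
    simp [exec, State.setReal, hy]
  | seq c d hc hd =>
    have h1 := hc s
    have h2 := hd (exec ω c s).1
    refine ⟨fun x hx => ?_, fun a ha => ?_⟩
    · simp only [Cmd.natWrites, List.mem_append, not_or] at hx
      exact (h2.1 x hx.2).trans (h1.1 x hx.1)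
    · simp only [Cmd.realWrites, List.mem_append, not_or] at ha
      exact (h2.2 a ha.2).trans (h1.2 a ha.1)
  | ite b c d hc hd =>
    refine ⟨fun x hx => ?_, fun a ha => ?_⟩
    · simp only [Cmd.natWrites, List.mem_append, not_or] at hx
      rw [exec]
      split_ifs
      · exact (hc s).1 x hx.1
      · exact (hd s).1 x hx.2
    · simp only [Cmd.realWrites, List.mem_append, not_or] at ha
      rw [exec]
      split_ifs
      · exact (hc s).2 a ha.1
      · exact (hd s).2 a ha.2
  | loop n b c hc => exact iter_frame (c := c) hc _ s

lemma exec_steps_le (ω : ℕ → unitInterval) {c : Cmd} (hc : c.loopFree = true) (s : State) :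
    (exec ω c s).2 ≤ c.stepBound := by
  induction c generalizing s with
  | skip => exact le_rfl
  | setNat x e => exact le_rfl
  | setReal a e f => exact le_rfl
  | sample a e => exact le_rfl
  | seq c d ihc ihd =>
    simp only [Cmd.loopFree, Bool.and_eq_true] at hc
    exact add_le_add (ihc hc.1 _) (ihd hc.2 _)
  | ite b c d ihc ihd =>
    simp only [Cmd.loopFree, Bool.and_eq_true] at hc
    have h1 := ihc hc.1 s
    have h2 := ihd hc.2 s
    rw [exec, Cmd.stepBound]
    split_ifs <;> simp only <;> omega
  | loop n b c _ => simp [Cmd.loopFree] at hc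

/-- Here `m` is the exact number of executions. The test must fail after them only if the cap `n`
has not been reached, because at the cap it is not evaluated. The induction removes the first
execution and shifts the invariant. -/
lemma iter_rule {b : Test} {f : State → State × ℕ} {B : ℕ} {Inv : ℕ → State → Prop} (m : ℕ)
    {n : ℕ} (hm : m ≤ n) {s : State} (h0 : Inv 0 s) (hhold : ∀ i < m, ∀ s', Inv i s' → b.Holds s')
    (hdone : m < n → ∀ s', Inv m s' → ¬ b.Holds s')
    (hstep : ∀ i < m, ∀ s', Inv i s' → Inv (i + 1) (f s').1 ∧ (f s').2 ≤ B) :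
    Inv m (iter b f n s).1 ∧ (iter b f n s).2 ≤ m * (b.cost + 1 + B) + b.cost + 1 := by
  induction m generalizing n s Inv with
  | zero =>
    cases n with
    | zero => exact ⟨h0, by simp [iter]⟩
    | succ n =>
      rw [iter, if_neg (hdone (by omega) s h0)]
      exact ⟨h0, by simp⟩
  | succ m ih =>
    obtain ⟨n, rfl⟩ : ∃ n', n = n' + 1 := ⟨n - 1, by omega⟩
    rw [iter, if_pos (hhold 0 (by omega) s h0)]
    have h1 := hstep 0 (by omega) s h0
    have h2 := ih (Inv := fun i => Inv (i + 1)) (n := n) (by omega) h1.1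
      (fun i hi => hhold (i + 1) (by omega)) (fun h => hdone (by omega))
      (fun i hi => hstep (i + 1) (by omega))
    refine ⟨h2.1, ?_⟩
    have h3 := h2.2
    have h4 := h1.2
    simp only
    nlinarith

/-- The loop rule: the loop body is executed exactly `m` times. -/
lemma exec_loop {ω : ℕ → unitInterval} {n : NatExpr} {b : Test} {c : Cmd} {s : State} (m B : ℕ)
    (Inv : ℕ → State → Prop) (hm : m ≤ n.eval s) (h0 : Inv 0 s)
    (hhold : ∀ i < m, ∀ s', Frame c s s' → Inv i s' → b.Holds s')
    (hdone : m < n.eval s → ∀ s', Frame c s s' → Inv m s' → ¬ b.Holds s')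
    (hstep : ∀ i < m, ∀ s', Frame c s s' → Inv i s' →
      Inv (i + 1) (exec ω c s').1 ∧ (exec ω c s').2 ≤ B) :
    Inv m (exec ω (.loop n b c) s).1 ∧
      (exec ω (.loop n b c) s).2 ≤ n.cost + 1 + (m * (b.cost + 1 + B) + b.cost + 1) := by
  have h := iter_rule (b := b) (f := exec ω c) (B := B)
    (Inv := fun i s' => Frame c s s' ∧ Inv i s') m hm (s := s) ⟨Frame.refl c s, h0⟩
    (fun i hi s' h => hhold i hi s' h.1 h.2) (fun hlt s' h => hdone hlt s' h.1 h.2)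
    (fun i hi s' h => ⟨⟨h.1.trans (exec_frame ω c s'), (hstep i hi s' h.1 h.2).1⟩,
      (hstep i hi s' h.1 h.2).2⟩)
  exact ⟨h.1.2, add_le_add_right h.2 _⟩

/-- `for` loops. -/
def Cmd.times (n : NatExpr) (c : Cmd) : Cmd := .loop n (.natEq (.lit 0) (.lit 0)) c

lemma exec_times {ω : ℕ → unitInterval} {n : NatExpr} {c : Cmd} {s : State} (B : ℕ)
    (Inv : ℕ → State → Prop) (h0 : Inv 0 s)
    (hstep : ∀ i < n.eval s, ∀ s', Frame c s s' → Inv i s' →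
      Inv (i + 1) (exec ω c s').1 ∧ (exec ω c s').2 ≤ B) :
    Inv (n.eval s) (exec ω (c.times n) s).1 ∧
      (exec ω (c.times n) s).2 ≤ n.cost + 5 + n.eval s * (B + 4) := by
  have h := exec_loop (ω := ω) (b := .natEq (.lit 0) (.lit 0)) (n.eval s) B Inv le_rfl h0
    (fun _ _ _ _ _ => rfl) (fun h => absurd h (lt_irrefl _)) hstep
  refine ⟨h.1, h.2.trans ?_⟩
  simp only [Test.cost, NatExpr.cost]
  nlinarith

lemma exec_seq_snd (ω : ℕ → unitInterval) (c d : Cmd) (s : State) :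
    (exec ω (c.seq d) s).2 = (exec ω c s).2 + (exec ω d (exec ω c s).1).2 := rfl


/-! ### The program for choosing an expert -/

/-- Cell `0` of an array, used as a variable. -/
def cell (a : ℕ) : RealExpr := .get a (.lit 0)

/-- Increment an integer register. -/
def incr (x : ℕ) : Cmd := .setNat x (.add (.var x) (.lit 1))

/-- Compute the probability of the current node, and make its expert the current action if the
threshold of the node lies below it. -/
def chooseNode : Cmd :=
  (Cmd.setReal 5 (.var 6)
    (.mul (.exp (.mul (.lit (-12)) (.ofNat (.var 7)))) (.exp (.get 2 (.var 6))))).seq <|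
  (Cmd.setReal 8 (.lit 0) (.add (cell 8) (.get 5 (.var 6)))).seq <|
  (Cmd.setReal 5 (.var 6) (.div (.get 5 (.var 6)) (cell 8))).seq <|
  (Cmd.ite (.realLt (.get 3 (.var 6)) (.get 5 (.var 6))) (.setNat 2 (.var 5)) .skip).seq <|
  (incr 5).seq (incr 6)

/-- Registers `4`, `5`, `6` count the scale, the expert and the node `j * N + i`. Cell `0` of array
`8` is the running total weight, started at the weight of the base. Arrays `2` and `4` hold the
log-weights of experts and bases, array `3` the thresholds, and array `5` keeps the node
probabilities for the update. -/
def chooseScale : Cmd :=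
  (Cmd.setReal 8 (.lit 0) (.exp (.get 4 (.var 4)))).seq <|
  (Cmd.setNat 5 (.lit 0)).seq <|
  (chooseNode.times (.var 0)).seq (incr 4)

def chooseCmd : Cmd :=
  (Cmd.setNat 2 (.lit 0)).seq <|
  (Cmd.setNat 4 (.lit 0)).seq <|
  (Cmd.setNat 6 (.lit 0)).seq (chooseScale.times (.var 3))

/-- The probabilities of all nodes, where node `j * N + i` is expert `i` on scale `j`. -/
noncomputable def chainProb (N T : ℕ) (σ : Logs) (m : ℕ) : ℝ :=
  nodeProb (logSize N T) (σ.base (m / N)) (σ.expert (m / N)) (m % N)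

/-- The state of the machine between two rounds. -/
structure Ready (N T : ℕ) (D : ℝ) (ω : ℕ → unitInterval) (σ : Logs) (s : State) : Prop where
  card : s.nat 0 = N
  horizon : s.nat 1 = T
  scales : s.nat 3 = scaleCount N T D
  size : s.nat 7 = logSize N T
  switchCost : s.real 1 0 = D
  threshold : ∀ m < scaleCount N T D * N, s.real 3 m = ω m
  expert : ∀ m < scaleCount N T D * N, s.real 2 m = σ.expert (m / N) (m % N)
  base : ∀ j < scaleCount N T D, s.real 4 j = σ.base j

lemma Ready.frame {N T : ℕ} {D : ℝ} {ω : ℕ → unitInterval} {σ : Logs} {c : Cmd} {s s' : State}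
    (h : Ready N T D ω σ s) (hf : Frame c s s') (h0 : ∀ x ∈ [0, 1, 3, 7], x ∉ c.natWrites)
    (h1 : ∀ a ∈ [1, 2, 3, 4], a ∉ c.realWrites) : Ready N T D ω σ s' where
  card := (hf.1 0 (h0 0 (by simp))).trans h.card
  horizon := (hf.1 1 (h0 1 (by simp))).trans h.horizon
  scales := (hf.1 3 (h0 3 (by simp))).trans h.scales
  size := (hf.1 7 (h0 7 (by simp))).trans h.size
  switchCost := by rw [hf.2 1 (h1 1 (by simp))]; exact h.switchCost
  threshold := by rw [hf.2 3 (h1 3 (by simp))]; exact h.threshold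
  expert := by rw [hf.2 2 (h1 2 (by simp))]; exact h.expert
  base := by rw [hf.2 4 (h1 4 (by simp))]; exact h.base

lemma node_div {N j i : ℕ} (hi : i < N) : (j * N + i) / N = j := by
  rw [mul_comm, Nat.mul_add_div (by omega), Nat.div_eq_of_lt hi, add_zero]

lemma node_mod {N j i : ℕ} (hi : i < N) : (j * N + i) % N = i := by
  rw [mul_comm, Nat.mul_add_mod, Nat.mod_eq_of_lt hi]

lemma node_lt {N J j i : ℕ} (hj : j < J) (hi : i < N) : j * N + i < J * N := by
  calc j * N + i < j * N + N := by omega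
    _ = (j + 1) * N := by ring
    _ ≤ J * N := Nat.mul_le_mul_right _ hj

section

variable {N T : ℕ} {D : ℝ} {ω : ℕ → unitInterval} {σ : Logs}

/-- The state of the machine after the choice among the first `m` nodes. -/
structure Chosen (N T : ℕ) (ω : ℕ → unitInterval) (σ : Logs) (m : ℕ) (s : State) : Prop where
  node : s.nat 6 = m
  prob : ∀ n < m, s.real 5 n = chainProb N T σ n
  action : s.nat 2 = chainAction (chainProb N T σ) (· % N) ω m

/-- The running total already includes the earlier experts, so one addition and one division give
the conditional probability. A later successful node overwrites register `2`, as in `chainAction`.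
-/
lemma exec_chooseNode {s : State} (h : Ready N T D ω σ s) {j i : ℕ} (hj : j < scaleCount N T D)
    (hi : i < N) (hc : Chosen N T ω σ (j * N + i) s) (h5 : s.nat 5 = i)
    (h8 : s.real 8 0 = totalWeight (logSize N T) (σ.base j) (σ.expert j) i) :
    Chosen N T ω σ (j * N + (i + 1)) (exec ω chooseNode s).1 ∧
      (exec ω chooseNode s).1.nat 5 = i + 1 ∧
      (exec ω chooseNode s).1.real 8 0
        = totalWeight (logSize N T) (σ.base j) (σ.expert j) (i + 1) := by
  have hy := h.expert _ (node_lt hj hi)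
  have hω := h.threshold _ (node_lt hj hi)
  rw [node_div hi, node_mod hi] at hy
  have hq : chainProb N T σ (j * N + i)
      = Real.exp (-12 * logSize N T) * Real.exp (σ.expert j i) /
        totalWeight (logSize N T) (σ.base j) (σ.expert j) (i + 1) := by
    rw [chainProb, node_div hi, node_mod hi, nodeProb]
  have hq' := hq
  rw [totalWeight_succ] at hq'
  refine ⟨⟨?_, ?_, ?_⟩, ?_, ?_⟩
  · simp [chooseNode, incr, cell, exec, State.setNat, State.setReal, RealExpr.eval, NatExpr.eval,
      Test.Holds, hc.node]
    split_ifs <;> simp [hc.node, add_assoc]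
  · intro n hn
    have : (exec ω chooseNode s).1.real 5 n
        = if n = j * N + i then chainProb N T σ (j * N + i) else s.real 5 n := by
      rw [hq']
      simp [chooseNode, incr, cell, exec, State.setNat, State.setReal, RealExpr.eval, NatExpr.eval,
        Test.Holds, hc.node, h.size, h8, hy]
      split_ifs <;> simp_all [Function.update]
    rw [this]
    split_ifs with he
    · rw [he]
    · exact hc.prob n (by omega)
  · rw [← add_assoc, chainAction, hq', ← hω, node_mod hi]
    simp [chooseNode, incr, cell, exec, State.setNat, State.setReal, RealExpr.eval, NatExpr.eval,
        Test.Holds, hc.node, h.size, h8, hy, h5]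
    split_ifs <;> simp [hc.action]
  · simp [chooseNode, incr, cell, exec, State.setNat, State.setReal, RealExpr.eval, NatExpr.eval,
      Test.Holds]
    split_ifs <;> simp [h5]
  · rw [totalWeight_succ]
    simp [chooseNode, incr, cell, exec, State.setNat, State.setReal, RealExpr.eval, NatExpr.eval,
        Test.Holds, hc.node, h.size, h8, hy]
    split_ifs <;> simp

lemma exec_chooseScale {s : State} (h : Ready N T D ω σ s) {j : ℕ} (hj : j < scaleCount N T D)
    (hc : Chosen N T ω σ (j * N) s) (h4 : s.nat 4 = j) :
    (Chosen N T ω σ ((j + 1) * N) (exec ω chooseScale s).1 ∧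
      (exec ω chooseScale s).1.nat 4 = j + 1) ∧
      (exec ω chooseScale s).2 ≤ 20 + 60 * N := by
  set s₁ := (exec ω (Cmd.setReal 8 (.lit 0) (.exp (.get 4 (.var 4)))) s).1 with hs₁
  set s₂ := (exec ω (Cmd.setNat 5 (.lit 0)) s₁).1 with hs₂
  have f₁ : Frame _ s s₁ := exec_frame ω _ s
  have f₂ : Frame _ s₁ s₂ := exec_frame ω _ s₁
  have r₂ : Ready N T D ω σ s₂ := (h.frame f₁ (by decide) (by decide)).frame f₂ (by decide) (by decide)
  have hN : (NatExpr.var 0).eval s₂ = N := r₂.card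
  have hloop := exec_times (ω := ω) (n := .var 0) (c := chooseNode) (s := s₂) 56
    (fun i s' => Chosen N T ω σ (j * N + i) s' ∧ s'.nat 5 = i ∧
      s'.real 8 0 = totalWeight (logSize N T) (σ.base j) (σ.expert j) i) ?_ ?_
  · rw [hN] at hloop
    obtain ⟨⟨hc', -, -⟩, hcost⟩ := hloop
    set s₃ := (exec ω (chooseNode.times (.var 0)) s₂).1 with hs₃
    have f₃ : Frame _ s₂ s₃ := exec_frame ω _ s₂
    have e : (exec ω chooseScale s).1 = (exec ω (incr 4) s₃).1 := rfl
    have f₄ : Frame _ s₃ (exec ω (incr 4) s₃).1 := exec_frame ω _ s₃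
    refine ⟨⟨⟨?_, ?_, ?_⟩, ?_⟩, ?_⟩
    · rw [e, f₄.1 6 (by decide), hc'.node]; ring
    · rw [e, f₄.2 5 (by decide)]
      intro n hn
      exact hc'.prob n (by linarith)
    · rw [e, f₄.1 2 (by decide), hc'.action]; congr 1; ring
    · have : (exec ω (incr 4) s₃).1.nat 4 = s₃.nat 4 + 1 := by
        simp [incr, exec, State.setNat, NatExpr.eval]
      rw [e, this, f₃.1 4 (by decide), f₂.1 4 (by decide), f₁.1 4 (by decide), h4]
    · have e2 : (exec ω chooseScale s).2 = 5 + (2 + ((exec ω (chooseNode.times (.var 0)) s₂).2 + 4)) := rfl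
      rw [e2]
      simp only [NatExpr.cost] at hcost
      omega
  · refine ⟨⟨?_, ?_, ?_⟩, ?_, ?_⟩
    · rw [f₂.1 6 (by decide), f₁.1 6 (by decide), hc.node, add_zero]
    · rw [f₂.2 5 (by decide), f₁.2 5 (by decide)]
      exact hc.prob
    · rw [f₂.1 2 (by decide), f₁.1 2 (by decide), hc.action, add_zero]
    · simp [hs₂, exec, State.setNat, NatExpr.eval]
    · rw [f₂.2 8 (by decide)]
      simp [hs₁, exec, State.setReal, NatExpr.eval, RealExpr.eval, h4, h.base j hj, totalWeight]
  · rintro i hi s' hf ⟨h1, h2, h3⟩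
    rw [hN] at hi
    exact ⟨exec_chooseNode (r₂.frame hf (by decide) (by decide)) hj hi h1 h2 h3,
      (exec_steps_le ω (by decide) s').trans (by decide)⟩

lemma exec_chooseCmd {s : State} (h : Ready N T D ω σ s) :
    Chosen N T ω σ (scaleCount N T D * N) (exec ω chooseCmd s).1 ∧
      (exec ω chooseCmd s).2 ≤ 12 + (24 + 60 * N) * scaleCount N T D := by
  set s₁ := (exec ω (Cmd.setNat 2 (.lit 0)) s).1 with hs₁
  set s₂ := (exec ω (Cmd.setNat 4 (.lit 0)) s₁).1 with hs₂
  set s₃ := (exec ω (Cmd.setNat 6 (.lit 0)) s₂).1 with hs₃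
  have r₁ := h.frame (exec_frame ω _ s : Frame _ s s₁) (by decide) (by decide)
  have r₂ := r₁.frame (exec_frame ω _ s₁ : Frame _ s₁ s₂) (by decide) (by decide)
  have r₃ := r₂.frame (exec_frame ω _ s₂ : Frame _ s₂ s₃) (by decide) (by decide)
  have hJ : (NatExpr.var 3).eval s₃ = scaleCount N T D := r₃.scales
  have hloop := exec_times (ω := ω) (n := .var 3) (c := chooseScale) (s := s₃) (20 + 60 * N)
    (fun j s' => Chosen N T ω σ (j * N) s' ∧ s'.nat 4 = j) ?_ ?_
  · rw [hJ] at hloop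
    refine ⟨hloop.1.1, ?_⟩
    have e : (exec ω chooseCmd s).2
      = 2 + (2 + (2 + (exec ω (chooseScale.times (.var 3)) s₃).2)) := rfl
    have := hloop.2
    simp only [NatExpr.cost] at this
    rw [e]
    nlinarith
  · refine ⟨⟨?_, ?_, ?_⟩, ?_⟩
    · simp [hs₃, exec, State.setNat, NatExpr.eval]
    · simp
    · simp [hs₃, hs₂, hs₁, exec, State.setNat, NatExpr.eval, chainAction]
    · simp [hs₃, hs₂, exec, State.setNat, NatExpr.eval]
  · rintro j hj s' hf ⟨h1, h2⟩
    rw [hJ] at hj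
    exact exec_chooseScale (r₃.frame hf (by decide) (by decide)) hj h1 h2

end


/-! ### The program for updating the weights -/

/-- `max (-5 L) e`, where `L` is the content of integer register `7`. -/
def clipped (e : RealExpr) : RealExpr :=
  -- The power with exponent `1` serves as a positive part, since it returns `0` on non-positive
  -- bases.
  .add (.mul (.lit (-5)) (.ofNat (.var 7)))
    (.pow (.add e (.mul (.lit 5) (.ofNat (.var 7)))) (.lit 1))

/-- The new log-weight of an entity with log-weight `y` and cost `z`. -/
def stepExpr (y z : RealExpr) : RealExpr :=
  clipped (.add (.sub y (.div y (cell 7))) (.mul (cell 6) (.sub (cell 9) z)))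

/-- The cost of the current expert on the current scale. -/
def costExpr : RealExpr := .add (.get 0 (.var 5)) (.mul (cell 1) (.mul (.lit 12) (cell 6)))

/-- Mix the cost of the current node into the current value. -/
def valueNode : Cmd :=
  (Cmd.setReal 9 (.lit 0) (.add (.mul (.get 5 (.var 6)) costExpr)
    (.mul (.sub (.lit 1) (.get 5 (.var 6))) (cell 9)))).seq <|
  (incr 5).seq (incr 6)

/-- Update the log-weight of the current node. -/
def weightNode : Cmd :=
  (Cmd.setReal 2 (.var 6) (stepExpr (.get 2 (.var 6)) costExpr)).seq <|
  (incr 5).seq (incr 6)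

/-- Two passes over the experts are needed because the weights are updated with the finished mixed
cost. Cell `0` of array `9` carries the value of the combination so far, and array `10` saves its
value before the scale, which is the cost of the base. -/
def updateScale : Cmd :=
  (Cmd.setReal 10 (.lit 0) (cell 9)).seq <|
  (Cmd.setNat 5 (.lit 0)).seq <|
  (valueNode.times (.var 0)).seq <|
  (Cmd.setReal 4 (.var 4) (stepExpr (.get 4 (.var 4)) (cell 10))).seq <|
  (Cmd.setNat 5 (.lit 0)).seq <|
  -- Rewinds the node counter to the start of the scale for the second pass.
  (Cmd.setNat 6 (.sub (.var 6) (.var 0))).seq <|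
  (weightNode.times (.var 0)).seq <|
  (Cmd.setReal 6 (.lit 0) (.mul (.lit 2) (cell 6))).seq <|
  (Cmd.setReal 7 (.lit 0) (.div (cell 7) (.lit 4))).seq (incr 4)

/-- The learning rate on the longest scale. -/
def rateExpr : RealExpr :=
  .pow (.div (.ofNat (.var 7)) (.mul (.mul (.lit 16) (.ofNat (.var 1))) (.add (cell 1) (.lit 1))))
    (.lit (1 / 2))

def updateCmd : Cmd :=
  (Cmd.setReal 9 (.lit 0) (cell 0)).seq <|
  (Cmd.setReal 6 (.lit 0) rateExpr).seq <|
  (Cmd.setReal 7 (.lit 0) (.ofNat (.var 1))).seq <|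
  (Cmd.setNat 4 (.lit 0)).seq <|
  (Cmd.setNat 6 (.lit 0)).seq (updateScale.times (.var 3))

lemma eval_stepExpr (s : State) (y z : RealExpr) :
    (stepExpr y z).eval s = stepLog (s.nat 7) (s.real 6 0) (s.real 7 0) (y.eval s)
      (s.real 9 0 - z.eval s) := by
  simp only [stepExpr, clipped, stepLog, RealExpr.eval, NatExpr.eval, cell]
  push_cast
  rw [Real.rpow_one]
  split_ifs with h
  · rw [max_eq_right (by linarith)]; ring
  · rw [max_eq_left (by linarith)]; ring

/-- The logs in which the first `k` base weights and the first `m` nodes have been updated. -/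
noncomputable def mixedLogs (N : ℕ) (σ σ' : Logs) (k m : ℕ) : Logs where
  base j := if j < k then σ'.base j else σ.base j
  expert j i := if j * N + i < m then σ'.expert j i else σ.expert j i

section

variable {N T : ℕ} {D : ℝ} {ω : ℕ → unitInterval} {σ : Logs} {x : ℕ → ℝ}

/-- The data available during the update on scale `j`. -/
structure Env (N T : ℕ) (D : ℝ) (σ : Logs) (x : ℕ → ℝ) (j : ℕ) (s : State) : Prop where
  loss : ∀ i < N, s.real 0 i = x i
  prob : ∀ m < scaleCount N T D * N, s.real 5 m = chainProb N T σ m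
  rate : s.real 6 0 = rate N T D j
  scale : s.real 7 0 = timeScale T j
  index : s.nat 4 = j

lemma Env.frame {j : ℕ} {c : Cmd} {s s' : State} (h : Env N T D σ x j s) (hf : Frame c s s')
    (h0 : 4 ∉ c.natWrites) (h1 : ∀ a ∈ [0, 5, 6, 7], a ∉ c.realWrites) : Env N T D σ x j s' where
  loss := by rw [hf.2 0 (h1 0 (by simp))]; exact h.loss
  prob := by rw [hf.2 5 (h1 5 (by simp))]; exact h.prob
  rate := by rw [hf.2 6 (h1 6 (by simp))]; exact h.rate
  scale := by rw [hf.2 7 (h1 7 (by simp))]; exact h.scale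
  index := by rw [hf.1 4 h0]; exact h.index

lemma eval_costExpr {ρ : Logs} {j : ℕ} {s : State} (h : Ready N T D ω ρ s) (he : Env N T D σ x j s)
    (hi : s.nat 5 < N) : costExpr.eval s = nodeCost N T D x j (s.nat 5) := by
  simp [costExpr, cell, RealExpr.eval, NatExpr.eval, he.rate, h.switchCost, he.loss _ hi, nodeCost]

lemma exec_valueNode {ρ : Logs} {j i : ℕ} {s : State} (h : Ready N T D ω ρ s)
    (he : Env N T D σ x j s) (hj : j < scaleCount N T D) (hi : i < N) (h5 : s.nat 5 = i)
    (h6 : s.nat 6 = j * N + i) {z₀ : ℝ}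
    (h9 : s.real 9 0 = mix (nodeProb (logSize N T) (σ.base j) (σ.expert j)) (nodeCost N T D x j)
      z₀ i) :
    (exec ω valueNode s).1.nat 5 = i + 1 ∧ (exec ω valueNode s).1.nat 6 = j * N + (i + 1) ∧
    (exec ω valueNode s).1.real 9 0
      = mix (nodeProb (logSize N T) (σ.base j) (σ.expert j)) (nodeCost N T D x j) z₀ (i + 1) := by
  have hq := he.prob _ (node_lt hj hi)
  rw [chainProb, node_div hi, node_mod hi] at hq
  have hc := eval_costExpr h he (by rw [h5]; exact hi)
  refine ⟨?_, ?_, ?_⟩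
  · simp [valueNode, incr, exec, State.setNat, State.setReal, NatExpr.eval, h5]
  · simp [valueNode, incr, exec, State.setNat, State.setReal, NatExpr.eval, h6, add_assoc]
  · simp [valueNode, incr, cell, exec, State.setNat, State.setReal, NatExpr.eval, RealExpr.eval, hc,
      h5, h6, hq, h9, mix]

lemma exec_weightNode {σ' : Logs} {j i : ℕ} {s : State}
    (h : Ready N T D ω (mixedLogs N σ σ' (j + 1) (j * N + i)) s)
    (he : Env N T D σ x j s) (hj : j < scaleCount N T D) (hi : i < N) (h5 : s.nat 5 = i)
    (h6 : s.nat 6 = j * N + i)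
    (h9 : σ'.expert j i = stepLog (logSize N T) (rate N T D j) (timeScale T j) (σ.expert j i)
      (s.real 9 0 - nodeCost N T D x j i)) :
    (exec ω weightNode s).1.nat 5 = i + 1 ∧ (exec ω weightNode s).1.nat 6 = j * N + (i + 1) ∧
    Ready N T D ω (mixedLogs N σ σ' (j + 1) (j * N + (i + 1))) (exec ω weightNode s).1 := by
  have hc := eval_costExpr h he (by rw [h5]; exact hi)
  have hy := h.expert _ (node_lt hj hi)
  rw [node_div hi, node_mod hi] at hy
  simp only [mixedLogs, lt_irrefl, if_false] at hy
  have hf : Frame _ s (exec ω weightNode s).1 := exec_frame ω _ s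
  refine ⟨?_, ?_, ?_⟩
  · simp [weightNode, incr, exec, State.setNat, State.setReal, NatExpr.eval, h5]
  · simp [weightNode, incr, exec, State.setNat, State.setReal, NatExpr.eval, h6, add_assoc]
  · refine ⟨?_, ?_, ?_, ?_, ?_, ?_, ?_, ?_⟩
    · rw [hf.1 0 (by decide)]; exact h.card
    · rw [hf.1 1 (by decide)]; exact h.horizon
    · rw [hf.1 3 (by decide)]; exact h.scales
    · rw [hf.1 7 (by decide)]; exact h.size
    · rw [hf.2 1 (by decide)]; exact h.switchCost
    · rw [hf.2 3 (by decide)]; exact h.threshold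
    · intro m hm
      have e : (exec ω weightNode s).1.real 2 m
          = if m = j * N + i then σ'.expert j i else s.real 2 m := by
        rw [h9]
        simp only [weightNode, incr, exec, State.setNat, State.setReal, NatExpr.eval,
          Function.update_self, eval_stepExpr, hc, h5, h6, h.size, he.rate, he.scale, RealExpr.eval,
          hy, Function.update_apply]
      rw [e, h.expert m hm]
      simp only [mixedLogs, Nat.div_add_mod']
      split_ifs with h1 h2 h3 h4 <;> first | rfl | omega | skip
      rw [h1, node_div hi, node_mod hi]
    · rw [hf.2 4 (by decide)]; exact h.base

/-- The updates are in place, so the invariant uses `mixedLogs`. Overwriting is harmless: the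
probabilities were stored before, and each log-weight is read only for its own update. -/
lemma exec_updateScale {j : ℕ} {s : State}
    (h : Ready N T D ω (mixedLogs N σ (logsStep N T D σ x) j (j * N)) s)
    (he : Env N T D σ x j s) (hj : j < scaleCount N T D) (h6 : s.nat 6 = j * N)
    (h9 : s.real 9 0 = value N T D σ x j) :
    (Ready N T D ω (mixedLogs N σ (logsStep N T D σ x) (j + 1) ((j + 1) * N))
        (exec ω updateScale s).1 ∧
      Env N T D σ x (j + 1) (exec ω updateScale s).1 ∧
      (exec ω updateScale s).1.nat 6 = (j + 1) * N ∧
      (exec ω updateScale s).1.real 9 0 = value N T D σ x (j + 1)) ∧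
    (exec ω updateScale s).2 ≤ 200 + 200 * N := by
  set σ' := logsStep N T D σ x with hσ'
  set s₁ := (exec ω (Cmd.setReal 10 (.lit 0) (cell 9)) s).1 with hs₁
  set s₂ := (exec ω (Cmd.setNat 5 (.lit 0)) s₁).1 with hs₂
  set s₃ := (exec ω (valueNode.times (.var 0)) s₂).1 with hs₃
  set s₄ := (exec ω (Cmd.setReal 4 (.var 4) (stepExpr (.get 4 (.var 4)) (cell 10))) s₃).1 with hs₄
  set s₅ := (exec ω (Cmd.setNat 5 (.lit 0)) s₄).1 with hs₅
  set s₆ := (exec ω (Cmd.setNat 6 (.sub (.var 6) (.var 0))) s₅).1 with hs₆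
  set s₇ := (exec ω (weightNode.times (.var 0)) s₆).1 with hs₇
  set s₈ := (exec ω (Cmd.setReal 6 (.lit 0) (.mul (.lit 2) (cell 6))) s₇).1 with hs₈
  set s₉ := (exec ω (Cmd.setReal 7 (.lit 0) (.div (cell 7) (.lit 4))) s₈).1 with hs₉
  have e : (exec ω updateScale s).1 = (exec ω (incr 4) s₉).1 := rfl
  have f₁ : Frame _ s s₁ := exec_frame ω _ s
  have f₂ : Frame _ s₁ s₂ := exec_frame ω _ s₁
  have f₃ : Frame _ s₂ s₃ := exec_frame ω _ s₂
  have f₄ : Frame _ s₃ s₄ := exec_frame ω _ s₃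
  have f₅ : Frame _ s₄ s₅ := exec_frame ω _ s₄
  have f₆ : Frame _ s₅ s₆ := exec_frame ω _ s₅
  have f₇ : Frame _ s₆ s₇ := exec_frame ω _ s₆
  have f₈ : Frame _ s₇ s₈ := exec_frame ω _ s₇
  have f₉ : Frame _ s₈ s₉ := exec_frame ω _ s₈
  have f₁₀ : Frame _ s₉ (exec ω (incr 4) s₉).1 := exec_frame ω _ s₉
  have r₂ := (h.frame f₁ (by decide) (by decide)).frame f₂ (by decide) (by decide)
  have e₂ := (he.frame f₁ (by decide) (by decide)).frame f₂ (by decide) (by decide)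
  have r₃ := r₂.frame f₃ (by decide) (by decide)
  have e₃ := e₂.frame f₃ (by decide) (by decide)
  have hN₂ : (NatExpr.var 0).eval s₂ = N := r₂.card
  have hv : value N T D σ x (j + 1) = mix (nodeProb (logSize N T) (σ.base j) (σ.expert j))
    (nodeCost N T D x j) (value N T D σ x j) N := rfl
  have hloop₁ := exec_times (ω := ω) (n := .var 0) (c := valueNode) (s := s₂) 50
    (fun i s' => s'.nat 5 = i ∧ s'.nat 6 = j * N + i ∧ s'.real 9 0 =
      mix (nodeProb (logSize N T) (σ.base j) (σ.expert j)) (nodeCost N T D x j)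
        (value N T D σ x j) i)
    ⟨by simp [hs₂, exec, State.setNat, NatExpr.eval],
      by rw [f₂.1 6 (by decide), f₁.1 6 (by decide), h6, add_zero],
      by rw [f₂.2 9 (by decide), f₁.2 9 (by decide), h9]; rfl⟩
    (by
      rintro i hi s' hf ⟨k1, k2, k3⟩
      rw [hN₂] at hi
      exact ⟨exec_valueNode (r₂.frame hf (by decide) (by decide)) (e₂.frame hf (by decide) (by decide))
        hj hi k1 k2 k3, (exec_steps_le ω (by decide) s').trans (by decide)⟩)
  rw [hN₂, ← hs₃, ← hv] at hloop₁
  obtain ⟨⟨-, h6₃, h9₃⟩, hcost₁⟩ := hloop₁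
  have h10 : s₃.real 10 0 = value N T D σ x j := by
    rw [f₃.2 10 (by decide), f₂.2 10 (by decide), ← h9]
    simp [hs₁, exec, State.setReal, NatExpr.eval, RealExpr.eval, cell]
  have r₄ : Ready N T D ω (mixedLogs N σ σ' (j + 1) (j * N)) s₄ := by
    refine ⟨?_, ?_, ?_, ?_, ?_, ?_, ?_, ?_⟩
    · rw [f₄.1 0 (by decide)]; exact r₃.card
    · rw [f₄.1 1 (by decide)]; exact r₃.horizon
    · rw [f₄.1 3 (by decide)]; exact r₃.scales
    · rw [f₄.1 7 (by decide)]; exact r₃.size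
    · rw [f₄.2 1 (by decide)]; exact r₃.switchCost
    · rw [f₄.2 3 (by decide)]; exact r₃.threshold
    · rw [f₄.2 2 (by decide)]; exact r₃.expert
    · intro n hn
      have hb := r₃.base j hj
      simp only [mixedLogs, lt_irrefl, if_false] at hb
      have e : s₄.real 4 n = if n = j then σ'.base j else s₃.real 4 n := by
        simp only [hs₄, exec, State.setReal, NatExpr.eval, Function.update_self, eval_stepExpr,
          RealExpr.eval, cell, e₃.index, Function.update_apply, h10, h9₃, hb, r₃.size, e₃.rate,
          e₃.scale, hσ', logsStep]
      rw [e, r₃.base n hn]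
      simp only [mixedLogs]
      split_ifs with h1 h2 h3 h4 <;> first | rfl | omega | skip
      rw [h1]
  have e₄ := e₃.frame f₄ (by decide) (by decide)
  have r₆ := (r₄.frame f₅ (by decide) (by decide)).frame f₆ (by decide) (by decide)
  have e₆ := (e₄.frame f₅ (by decide) (by decide)).frame f₆ (by decide) (by decide)
  have hN₆ : (NatExpr.var 0).eval s₆ = N := r₆.card
  have h9₆ : s₆.real 9 0 = value N T D σ x (j + 1) := by
    rw [f₆.2 9 (by decide), f₅.2 9 (by decide), f₄.2 9 (by decide), h9₃]
  have hloop₂ := exec_times (ω := ω) (n := .var 0) (c := weightNode) (s := s₆) 100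
    (fun i s' => s'.nat 5 = i ∧ s'.nat 6 = j * N + i ∧
      Ready N T D ω (mixedLogs N σ σ' (j + 1) (j * N + i)) s')
    ⟨by rw [f₆.1 5 (by decide)]; simp [hs₅, exec, State.setNat, NatExpr.eval],
      by
        have : s₆.nat 6 = s₅.nat 6 - s₅.nat 0 := by simp [hs₆, exec, State.setNat, NatExpr.eval]
        rw [this, f₅.1 6 (by decide), f₄.1 6 (by decide), h6₃, f₅.1 0 (by decide), r₄.card]
        simp,
      r₆⟩
    (by
      rintro i hi s' hf ⟨k1, k2, k3⟩
      rw [hN₆] at hi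
      refine ⟨exec_weightNode k3 (e₆.frame hf (by decide) (by decide)) hj hi k1 k2 ?_,
        (exec_steps_le ω (by decide) s').trans (by decide)⟩
      rw [hf.2 9 (by decide), h9₆]
      rfl)
  rw [hN₆, ← hs₇] at hloop₂
  obtain ⟨⟨-, h6₇, r₇⟩, hcost₂⟩ := hloop₂
  rw [← Nat.succ_mul, Nat.succ_eq_add_one] at h6₇ r₇
  have e₇ := e₆.frame f₇ (by decide) (by decide)
  refine ⟨⟨?_, ⟨?_, ?_, ?_, ?_, ?_⟩, ?_, ?_⟩, ?_⟩
  · rw [e]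
    exact ((r₇.frame f₈ (by decide) (by decide)).frame f₉ (by decide) (by decide)).frame f₁₀
      (by decide) (by decide)
  · rw [e, f₁₀.2 0 (by decide), f₉.2 0 (by decide), f₈.2 0 (by decide)]
    exact e₇.loss
  · rw [e, f₁₀.2 5 (by decide), f₉.2 5 (by decide), f₈.2 5 (by decide)]
    exact e₇.prob
  · rw [e, f₁₀.2 6 (by decide), f₉.2 6 (by decide), rate_succ, ← e₇.rate]
    simp [hs₈, exec, State.setReal, NatExpr.eval, RealExpr.eval, cell]
  · rw [e, f₁₀.2 7 (by decide)]
    have : s₉.real 7 0 = s₇.real 7 0 / 4 := by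
      rw [← f₈.2 7 (by decide)]
      simp [hs₉, exec, State.setReal, NatExpr.eval, RealExpr.eval, cell]
    rw [this, e₇.scale, timeScale, timeScale, pow_succ, div_div]
  · have : (exec ω (incr 4) s₉).1.nat 4 = s₉.nat 4 + 1 := by
      simp [incr, exec, State.setNat, NatExpr.eval]
    rw [e, this, f₉.1 4 (by decide), f₈.1 4 (by decide), e₇.index]
  · rw [e, f₁₀.1 6 (by decide), f₉.1 6 (by decide), f₈.1 6 (by decide), h6₇]
  · rw [e, f₁₀.2 9 (by decide), f₉.2 9 (by decide), f₈.2 9 (by decide), f₇.2 9 (by decide), h9₆]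
  · have c₁ : (exec ω (Cmd.setReal 10 (.lit 0) (cell 9)) s).2 ≤ 10 :=
      (exec_steps_le ω (by decide) s).trans (by decide)
    have c₂ : (exec ω (Cmd.setNat 5 (.lit 0)) s₁).2 ≤ 10 :=
      (exec_steps_le ω (by decide) s₁).trans (by decide)
    have c₄ : (exec ω (Cmd.setReal 4 (.var 4) (stepExpr (.get 4 (.var 4)) (cell 10))) s₃).2 ≤ 60 :=
      (exec_steps_le ω (by decide) s₃).trans (by decide)
    have c₅ : (exec ω (Cmd.setNat 5 (.lit 0)) s₄).2 ≤ 10 :=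
      (exec_steps_le ω (by decide) s₄).trans (by decide)
    have c₆ : (exec ω (Cmd.setNat 6 (.sub (.var 6) (.var 0))) s₅).2 ≤ 10 :=
      (exec_steps_le ω (by decide) s₅).trans (by decide)
    have c₈ : (exec ω (Cmd.setReal 6 (.lit 0) (.mul (.lit 2) (cell 6))) s₇).2 ≤ 10 :=
      (exec_steps_le ω (by decide) s₇).trans (by decide)
    have c₉ : (exec ω (Cmd.setReal 7 (.lit 0) (.div (cell 7) (.lit 4))) s₈).2 ≤ 10 :=
      (exec_steps_le ω (by decide) s₈).trans (by decide)
    have c₁₀ : (exec ω (incr 4) s₉).2 ≤ 10 := (exec_steps_le ω (by decide) s₉).trans (by decide)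
    simp only [NatExpr.cost] at hcost₁ hcost₂
    simp only [updateScale, exec_seq_snd]
    simp only [← hs₁, ← hs₂, ← hs₃, ← hs₄, ← hs₅, ← hs₆, ← hs₇, ← hs₈, ← hs₉]
    omega

end


/-! ### Initialization and correctness of whole rounds -/

/-- The length of the shortest time scale. -/
def minScaleExpr : RealExpr :=
  .mul (.mul (.lit 10000) (.ofNat (.var 7))) (.add (cell 1) (.lit 1))

def doubleCmd : Cmd := (Cmd.setNat 8 (.mul (.var 8) (.lit 2))).seq (incr 7)

def quarterCmd : Cmd := (Cmd.setReal 7 (.lit 0) (.div (cell 7) (.lit 4))).seq (incr 3)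

def sampleCmd : Cmd := (Cmd.sample 3 (.var 6)).seq (incr 6)

/-- There is no logarithm among the operations: `logSize` is found by doubling and `scaleCount` by
quartering. All randomness is drawn here, one threshold per node. -/
def initCmd : Cmd :=
  (Cmd.setNat 8 (.lit 1)).seq <|
  (Cmd.loop (.mul (.var 0) (.var 1)) (.natLt (.var 8) (.mul (.var 0) (.var 1))) doubleCmd).seq <|
  (Cmd.setReal 7 (.lit 0) (.ofNat (.var 1))).seq <|
  (Cmd.loop (.var 7) (.neg (.realLt (cell 7) minScaleExpr)) quarterCmd).seq
  (sampleCmd.times (.mul (.var 3) (.var 0)))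

/-- Discounted exponential weights on all time scales, with fixed thresholds. -/
def algorithm : Algorithm where
  init := initCmd
  choose := chooseCmd
  update := updateCmd

section

variable {N T : ℕ} {D : ℝ} {ω : ℕ → unitInterval}

lemma exec_updateCmd {σ : Logs} {x : ℕ → ℝ} {s : State} (hN : 1 ≤ N) (hT : 2 ≤ T)
    (hD : 0 ≤ D) (h : Ready N T D ω σ s)
    (hx : ∀ i < N, s.real 0 i = x i)
    (hq : ∀ m < scaleCount N T D * N, s.real 5 m = chainProb N T σ m) :
    Ready N T D ω (logsStep N T D σ x) (exec ω updateCmd s).1 ∧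
      (exec ω updateCmd s).2 ≤ 60 + scaleCount N T D * (204 + 200 * N) := by
  set s₁ := (exec ω (Cmd.setReal 9 (.lit 0) (cell 0)) s).1 with hs₁
  set s₂ := (exec ω (Cmd.setReal 6 (.lit 0) rateExpr) s₁).1 with hs₂
  set s₃ := (exec ω (Cmd.setReal 7 (.lit 0) (.ofNat (.var 1))) s₂).1 with hs₃
  set s₄ := (exec ω (Cmd.setNat 4 (.lit 0)) s₃).1 with hs₄
  set s₅ := (exec ω (Cmd.setNat 6 (.lit 0)) s₄).1 with hs₅
  have f₁ : Frame _ s s₁ := exec_frame ω _ s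
  have f₂ : Frame _ s₁ s₂ := exec_frame ω _ s₁
  have f₃ : Frame _ s₂ s₃ := exec_frame ω _ s₂
  have f₄ : Frame _ s₃ s₄ := exec_frame ω _ s₃
  have f₅ : Frame _ s₄ s₅ := exec_frame ω _ s₄
  have r₁ := h.frame f₁ (by decide) (by decide)
  have r₂ := r₁.frame f₂ (by decide) (by decide)
  have r₅ := ((r₂.frame f₃ (by decide) (by decide)).frame f₄ (by decide) (by decide)).frame f₅
    (by decide) (by decide)
  have hJ : (NatExpr.var 3).eval s₅ = scaleCount N T D := r₅.scales
  have hrate : s₂.real 6 0 = rate N T D 0 := by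
    simp only [hs₂, exec, State.setReal, NatExpr.eval, Function.update_self, rateExpr,
      RealExpr.eval, cell, r₁.size, r₁.horizon, r₁.switchCost, rate]
    push_cast
    rw [pow_zero, one_mul]
    -- The base of the power is positive, so the default value `0` does not occur.
    refine if_pos ?_
    have := one_le_logSize hN hT
    have : (0 : ℝ) < logSize N T := by exact_mod_cast this
    have : (0 : ℝ) < T := by exact_mod_cast (by omega : 0 < T)
    positivity
  have hloop := exec_times (ω := ω) (n := .var 3) (c := updateScale) (s := s₅) (200 + 200 * N)
    (fun j s' => Ready N T D ω (mixedLogs N σ (logsStep N T D σ x) j (j * N)) s' ∧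
      Env N T D σ x j s' ∧ s'.nat 6 = j * N ∧ s'.real 9 0 = value N T D σ x j)
    ?_ ?_
  · rw [hJ] at hloop
    obtain ⟨⟨hr, -⟩, hcost⟩ := hloop
    refine ⟨?_, ?_⟩
    · have e : (exec ω updateCmd s).1 = (exec ω (updateScale.times (.var 3)) s₅).1 := rfl
      rw [e]
      refine ⟨hr.card, hr.horizon, hr.scales, hr.size, hr.switchCost, hr.threshold, ?_, ?_⟩
      · intro m hm
        rw [hr.expert m hm]
        simp [mixedLogs, Nat.div_add_mod', hm]
      · intro j hj
        rw [hr.base j hj]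
        simp [mixedLogs, hj]
    · have c₁ : (exec ω (Cmd.setReal 9 (.lit 0) (cell 0)) s).2 ≤ 5 :=
        (exec_steps_le ω (by decide) s).trans (by decide)
      have c₂ : (exec ω (Cmd.setReal 6 (.lit 0) rateExpr) s₁).2 ≤ 20 :=
        (exec_steps_le ω (by decide) s₁).trans (by decide)
      have c₃ : (exec ω (Cmd.setReal 7 (.lit 0) (.ofNat (.var 1))) s₂).2 ≤ 5 :=
        (exec_steps_le ω (by decide) s₂).trans (by decide)
      have c₄ : (exec ω (Cmd.setNat 4 (.lit 0)) s₃).2 ≤ 5 :=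
        (exec_steps_le ω (by decide) s₃).trans (by decide)
      have c₅ : (exec ω (Cmd.setNat 6 (.lit 0)) s₄).2 ≤ 5 :=
        (exec_steps_le ω (by decide) s₄).trans (by decide)
      have e : scaleCount N T D * (200 + 200 * N + 4) = scaleCount N T D * (204 + 200 * N) := by ring
      simp only [NatExpr.cost, e] at hcost
      simp only [updateCmd, exec_seq_snd]
      simp only [← hs₁, ← hs₂, ← hs₃, ← hs₄, ← hs₅]
      omega
  · refine ⟨?_, ⟨?_, ?_, ?_, ?_, ?_⟩, ?_, ?_⟩
    · convert r₅
      simp [mixedLogs]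
    · rw [f₅.2 0 (by decide), f₄.2 0 (by decide), f₃.2 0 (by decide), f₂.2 0 (by decide),
        f₁.2 0 (by decide)]
      exact hx
    · rw [f₅.2 5 (by decide), f₄.2 5 (by decide), f₃.2 5 (by decide), f₂.2 5 (by decide),
        f₁.2 5 (by decide)]
      exact hq
    · rw [f₅.2 6 (by decide), f₄.2 6 (by decide), f₃.2 6 (by decide), hrate]
    · rw [f₅.2 7 (by decide), f₄.2 7 (by decide)]
      simp [hs₃, exec, State.setReal, NatExpr.eval, RealExpr.eval, r₂.horizon, timeScale]
    · rw [f₅.1 4 (by decide)]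
      simp [hs₄, exec, State.setNat, NatExpr.eval]
    · simp [hs₅, exec, State.setNat, NatExpr.eval]
    · rw [f₅.2 9 (by decide), f₄.2 9 (by decide), f₃.2 9 (by decide), f₂.2 9 (by decide), value,
        ← hx 0 hN]
      simp [hs₁, exec, State.setReal, NatExpr.eval, RealExpr.eval, cell]
  · rintro j hj s' hf ⟨k1, k2, k3, k4⟩
    rw [hJ] at hj
    exact exec_updateScale k1 k2 hj k3 k4

lemma exec_initCmd (hN : 1 ≤ N) (hT : 2 ≤ T) (hD : 0 ≤ D) :
    Ready N T D ω ⟨fun _ => 0, fun _ _ => 0⟩ (exec ω initCmd (initialState N T D)).1 ∧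
      (exec ω initCmd (initialState N T D)).2
        ≤ 100 * (logSize N T + 1) + 20 * (scaleCount N T D * N) := by
  set s₀ := initialState N T D with hs₀
  set s₁ := (exec ω (Cmd.setNat 8 (.lit 1)) s₀).1 with hs₁
  set s₂ := (exec ω (Cmd.loop (.mul (.var 0) (.var 1)) (.natLt (.var 8) (.mul (.var 0) (.var 1)))
    doubleCmd) s₁).1 with hs₂
  set s₃ := (exec ω (Cmd.setReal 7 (.lit 0) (.ofNat (.var 1))) s₂).1 with hs₃
  set s₄ := (exec ω (Cmd.loop (.var 7) (.neg (.realLt (cell 7) minScaleExpr)) quarterCmd) s₃).1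
    with hs₄
  set s₅ := (exec ω (sampleCmd.times (.mul (.var 3) (.var 0))) s₄).1 with hs₅
  have e : (exec ω initCmd s₀).1 = s₅ := rfl
  have f₁ : Frame _ s₀ s₁ := exec_frame ω _ s₀
  have f₂ : Frame _ s₁ s₂ := exec_frame ω _ s₁
  have f₃ : Frame _ s₂ s₃ := exec_frame ω _ s₂
  have f₄ : Frame _ s₃ s₄ := exec_frame ω _ s₃
  have f₅ : Frame _ s₄ s₅ := exec_frame ω _ s₄
  have d₁ : s₁.drawn = 0 := rfl
  have n0 : s₁.nat 0 = N := by rw [f₁.1 0 (by decide)]; simp [hs₀, initialState]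
  have n1 : s₁.nat 1 = T := by rw [f₁.1 1 (by decide)]; simp [hs₀, initialState]
  have hNT : (NatExpr.mul (.var 0) (.var 1)).eval s₁ = N * T := by simp [NatExpr.eval, n0, n1]
  have hNT' : ∀ s', Frame doubleCmd s₁ s' → s'.nat 0 * s'.nat 1 = N * T := fun s' hf => by
    rw [hf.1 0 (by decide), hf.1 1 (by decide), n0, n1]
  have hloop₁ := exec_loop (ω := ω) (n := .mul (.var 0) (.var 1))
    (b := .natLt (.var 8) (.mul (.var 0) (.var 1))) (c := doubleCmd) (s := s₁) (logSize N T) 20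
    (fun i s' => s'.nat 8 = 2 ^ i ∧ s'.nat 7 = i ∧ s'.drawn = 0)
    -- The cap `N * T` on the loop is never binding too early, since `N T ≤ 2 ^ (N T)`.
    (by rw [hNT]; exact Nat.clog_le_of_le_pow Nat.lt_two_pow_self.le)
    ⟨by simp [hs₁, exec, State.setNat, NatExpr.eval],
      by rw [f₁.1 7 (by decide)]; simp [hs₀, initialState], d₁⟩
    (by
      rintro i hi s' hf ⟨h1, -, -⟩
      simp only [Test.Holds, NatExpr.eval, hNT' s' hf, h1]
      exact (Nat.lt_clog_iff_pow_lt one_lt_two).1 hi)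
    (by
      rintro - s' hf ⟨h1, -, -⟩
      simp only [Test.Holds, NatExpr.eval, hNT' s' hf, h1, not_lt]
      exact Nat.le_pow_clog one_lt_two _)
    (by
      rintro i hi s' hf ⟨h1, h2, h3⟩
      refine ⟨⟨?_, ?_, ?_⟩, (exec_steps_le ω (by decide) s').trans (by decide)⟩
      · simp [doubleCmd, incr, exec, State.setNat, NatExpr.eval, h1, pow_succ]
      · simp [doubleCmd, incr, exec, State.setNat, NatExpr.eval, h2]
      · simp [doubleCmd, incr, exec, State.setNat, h3])
  rw [← hs₂] at hloop₁
  obtain ⟨⟨-, n7, d₂⟩, hcost₁⟩ := hloop₁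
  have m7 : s₃.nat 7 = logSize N T := by rw [f₃.1 7 (by decide), n7]
  have m1 : s₃.real 1 0 = D := by
    rw [f₃.2 1 (by decide), f₂.2 1 (by decide), f₁.2 1 (by decide)]; simp [hs₀, initialState]
  have hmin : ∀ s', Frame quarterCmd s₃ s' → minScaleExpr.eval s' = minScale N T D := fun s' hf => by
    simp only [minScaleExpr, RealExpr.eval, NatExpr.eval, cell, hf.1 7 (by decide),
      hf.2 1 (by decide), m7, m1, minScale]
    push_cast
    ring
  have hcell : ∀ s', (cell 7).eval s' = s'.real 7 0 := fun s' => by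
    simp [cell, RealExpr.eval, NatExpr.eval]
  have hloop₂ := exec_loop (ω := ω) (n := .var 7)
    (b := .neg (.realLt (cell 7) minScaleExpr)) (c := quarterCmd) (s := s₃) (scaleCount N T D) 20
    (fun i s' => s'.real 7 0 = timeScale T i ∧ s'.nat 3 = i ∧ s'.drawn = 0)
    (by simp only [NatExpr.eval, m7]; exact scaleCount_le_logSize hN hT hD)
    ⟨by simp [hs₃, exec, State.setReal, NatExpr.eval, RealExpr.eval, timeScale,
          f₂.1 1 (by decide), n1],
      by rw [f₃.1 3 (by decide), f₂.1 3 (by decide), f₁.1 3 (by decide)]; simp [hs₀, initialState],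
      d₂⟩
    (by
      rintro i hi s' hf ⟨h1, -, -⟩
      simp only [Test.Holds, hmin s' hf, hcell, h1, not_lt]
      exact minScale_le_timeScale hi)
    (by
      rintro - s' hf ⟨h1, -, -⟩
      simp only [Test.Holds, hmin s' hf, hcell, h1, not_not]
      exact timeScale_scaleCount_lt hN hT hD)
    (by
      rintro i hi s' hf ⟨h1, h2, h3⟩
      refine ⟨⟨?_, ?_, ?_⟩, (exec_steps_le ω (by decide) s').trans (by decide)⟩
      · simp [quarterCmd, incr, exec, State.setNat, State.setReal, NatExpr.eval, RealExpr.eval,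
          hcell, h1, timeScale, pow_succ, div_div]
      · simp [quarterCmd, incr, exec, State.setNat, State.setReal, NatExpr.eval, h2]
      · simp [quarterCmd, incr, exec, State.setNat, State.setReal, h3])
  rw [← hs₄] at hloop₂
  obtain ⟨⟨-, n3, d₄⟩, hcost₂⟩ := hloop₂
  have n0' : s₄.nat 0 = N := by
    rw [f₄.1 0 (by decide), f₃.1 0 (by decide), f₂.1 0 (by decide), n0]
  have hJN : (NatExpr.mul (.var 3) (.var 0)).eval s₄ = scaleCount N T D * N := by
    simp [NatExpr.eval, n3, n0']
  have hloop₃ := exec_times (ω := ω) (n := .mul (.var 3) (.var 0)) (c := sampleCmd) (s := s₄) 10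
    (fun i s' => s'.nat 6 = i ∧ s'.drawn = i ∧ ∀ m < i, s'.real 3 m = ω m)
    ⟨by rw [f₄.1 6 (by decide), f₃.1 6 (by decide), f₂.1 6 (by decide), f₁.1 6 (by decide)]
        simp [hs₀, initialState], d₄, fun m hm => absurd hm (Nat.not_lt_zero m)⟩
    (by
      rintro i hi s' hf ⟨h1, h2, h3⟩
      refine ⟨⟨?_, ?_, ?_⟩, (exec_steps_le ω (by decide) s').trans (by decide)⟩
      · simp [sampleCmd, incr, exec, State.setNat, State.setReal, NatExpr.eval, h1]
      · simp [sampleCmd, incr, exec, State.setNat, State.setReal, h2]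
      · intro m hm
        simp only [sampleCmd, incr, exec, State.setNat, State.setReal, NatExpr.eval, h1, h2,
          Function.update_self, Function.update_apply]
        split_ifs with he
        · rw [he]
        · exact h3 m (by omega))
  rw [hJN, ← hs₅] at hloop₃
  obtain ⟨⟨-, -, hω⟩, hcost₃⟩ := hloop₃
  refine ⟨?_, ?_⟩
  · rw [e]
    refine ⟨?_, ?_, ?_, ?_, ?_, hω, ?_, ?_⟩
    · rw [f₅.1 0 (by decide), n0']
    · rw [f₅.1 1 (by decide), f₄.1 1 (by decide), f₃.1 1 (by decide), f₂.1 1 (by decide), n1]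
    · rw [f₅.1 3 (by decide), n3]
    · rw [f₅.1 7 (by decide), f₄.1 7 (by decide), m7]
    · rw [f₅.2 1 (by decide), f₄.2 1 (by decide), m1]
    · intro m _
      rw [f₅.2 2 (by decide), f₄.2 2 (by decide), f₃.2 2 (by decide), f₂.2 2 (by decide),
        f₁.2 2 (by decide)]
      simp [hs₀, initialState]
    · intro j _
      rw [f₅.2 4 (by decide), f₄.2 4 (by decide), f₃.2 4 (by decide), f₂.2 4 (by decide),
        f₁.2 4 (by decide)]
      simp [hs₀, initialState]
  · have c₁ : (exec ω (Cmd.setNat 8 (.lit 1)) s₀).2 ≤ 5 :=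
      (exec_steps_le ω (by decide) s₀).trans (by decide)
    have c₃ : (exec ω (Cmd.setReal 7 (.lit 0) (.ofNat (.var 1))) s₂).2 ≤ 5 :=
      (exec_steps_le ω (by decide) s₂).trans (by decide)
    have hJ := scaleCount_le_logSize hN hT hD
    simp only [NatExpr.cost, Test.cost, RealExpr.cost, cell, minScaleExpr] at hcost₁ hcost₂ hcost₃
    simp only [initCmd, exec_seq_snd]
    simp only [← hs₁, ← hs₂, ← hs₃, ← hs₄]
    simp only [cell, minScaleExpr] at hs₄ ⊢
    omega

end


/-! ### Step count and expected regret of the algorithm -/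

section

variable {N T : ℕ} {D : ℝ} (hN : 1 ≤ N) (hT : 2 ≤ T) (hD : 0 ≤ D) {ω : ℕ → unitInterval}
  {l : ℕ → Fin N → ℝ}

/-- The losses of round `t + 1`, extended by zero. -/
noncomputable def paddedLoss (l : ℕ → Fin N → ℝ) (t i : ℕ) : ℝ :=
  if h : i < N then l (t + 1) ⟨i, h⟩ else 0

/-- The probabilities of the nodes in round `t + 1`. -/
noncomputable def roundProb (N T : ℕ) (D : ℝ) (l : ℕ → Fin N → ℝ) (t : ℕ) : ℕ → ℝ :=
  chainProb N T (logs N T D (paddedLoss l) t)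

include hN hT hD

/-- The stored log-weights depend only on the losses; the coins enter only through the fixed
thresholds. This makes the expectation a statement about deterministic probabilities. -/
lemma ready_stateAfter (l : ℕ → Fin N → ℝ) (ω : ℕ → unitInterval) (t : ℕ) :
    Ready N T D ω (logs N T D (paddedLoss l) t) (algorithm.stateAfter T D l ω t) := by
  induction t with
  | zero => exact (exec_initCmd hN hT hD).1
  | succ t ih =>
    have hc := exec_chooseCmd ih
    have hr := ih.frame (exec_frame ω chooseCmd _) (by decide) (by decide)
    refine (exec_updateCmd (x := paddedLoss l t) hN hT hD
      (s := (exec ω chooseCmd (algorithm.stateAfter T D l ω t)).1.reveal (l (t + 1)))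
      ⟨hr.card, hr.horizon, hr.scales, hr.size, hr.switchCost, hr.threshold, hr.expert, hr.base⟩
      ?_ hc.1.prob).1
    intro i _
    rfl

lemma action_succ (l : ℕ → Fin N → ℝ) (ω : ℕ → unitInterval) (t : ℕ) :
    algorithm.action T D l ω (t + 1)
      = chainAction (roundProb N T D l t) (· % N) ω (scaleCount N T D * N) :=
  (exec_chooseCmd (ready_stateAfter hN hT hD l ω t)).1.action

lemma roundCost_succ_le (l : ℕ → Fin N → ℝ) (ω : ℕ → unitInterval) (t : ℕ) :
    algorithm.roundCost T D l ω (t + 1) ≤ 72 + scaleCount N T D * (228 + 260 * N) := by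
  have ih := ready_stateAfter hN hT hD l ω t
  have hc := exec_chooseCmd ih
  have hr := ih.frame (exec_frame ω chooseCmd _) (by decide) (by decide)
  have hu := (exec_updateCmd (x := paddedLoss l t) hN hT hD
      (s := (exec ω chooseCmd (algorithm.stateAfter T D l ω t)).1.reveal (l (t + 1)))
      ⟨hr.card, hr.horizon, hr.scales, hr.size, hr.switchCost, hr.threshold, hr.expert, hr.base⟩
      (fun i _ => rfl) hc.1.prob).2
  have e : algorithm.roundCost T D l ω (t + 1)
      = (exec ω chooseCmd (algorithm.stateAfter T D l ω t)).2 + (exec ω updateCmd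
        ((exec ω chooseCmd (algorithm.stateAfter T D l ω t)).1.reveal (l (t + 1)))).2 := rfl
  rw [e]
  have := hc.2
  nlinarith

omit hD in
-- Initialization needs order `log (N T)` steps for the doubling loop; `log N ≤ N - 1` fits this
-- into the budget `N log T`.
lemma logSize_le_card_mul : (logSize N T : ℝ) ≤ 12 * (N * Real.log T) := by
  have h1 := logSize_le hN hT
  have hN' : (1 : ℝ) ≤ N := by exact_mod_cast hN
  have hT' : (2 : ℝ) ≤ T := by exact_mod_cast hT
  have h5 := Real.log_two_gt_d9
  have h7 := Real.log_le_log two_pos hT'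
  rw [Real.log_mul (by linarith) (by linarith)] at h1
  have h8 := Real.log_le_sub_one_of_pos (show (0 : ℝ) < N by linarith)
  nlinarith

lemma algorithm_runsWithin : RunsWithin algorithm N T D (10000 * ((N : ℝ) * Real.log T)) := by
  have hN' : (1 : ℝ) ≤ N := by exact_mod_cast hN
  have hT' : (2 : ℝ) ≤ T := by exact_mod_cast hT
  have h5 := Real.log_two_gt_d9
  have h7 := Real.log_le_log two_pos hT'
  have hJ := scaleCount_le hN hT hD
  have hJ0 : (0 : ℝ) ≤ scaleCount N T D := Nat.cast_nonneg _
  have hlog : (1 : ℝ) / 2 ≤ N * Real.log T := by nlinarith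
  have hJN : (scaleCount N T D : ℝ) * N ≤ 3 * (N * Real.log T) := by nlinarith
  have hJ1 : (scaleCount N T D : ℝ) ≤ 3 * (N * Real.log T) := by nlinarith
  intro l _ ω
  refine ⟨?_, fun t ht => ?_⟩
  · have h1 : algorithm.initCost N T D ω ≤ 100 * (logSize N T + 1) + 20 * (scaleCount N T D * N) :=
      (exec_initCmd hN hT hD).2
    have h2 : (algorithm.initCost N T D ω : ℝ)
        ≤ 100 * (logSize N T + 1) + 20 * (scaleCount N T D * N) := by exact_mod_cast h1
    have h3 := logSize_le_card_mul hN hT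
    linarith
  · obtain ⟨t, rfl⟩ : ∃ t', t = t' + 1 := ⟨t - 1, by have := (Finset.mem_Icc.1 ht).1; omega⟩
    refine ⟨?_, ?_⟩
    · rw [action_succ hN hT hD]
      exact chainAction_lt hN (fun n => Nat.mod_lt _ hN) _
    · have h1 := roundCost_succ_le hN hT hD l ω t
      have h2 : (algorithm.roundCost T D l ω (t + 1) : ℝ)
          ≤ 72 + scaleCount N T D * (228 + 260 * N) := by exact_mod_cast h1
      nlinarith

omit hN hT hD in
-- The nested combination of scales is one flat chain of `j * N` nodes, because the base of each
-- scale is the mixture of all earlier nodes.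
lemma mix_chainProb (σ : Logs) (x : ℕ → ℝ) (j : ℕ) :
    mix (chainProb N T σ) (fun m => nodeCost N T D x (m / N) (m % N)) (x 0) (j * N)
      = value N T D σ x j := by
  induction j with
  | zero => simp [mix, value]
  | succ j ih =>
    have h : ∀ i ≤ N, mix (chainProb N T σ) (fun m => nodeCost N T D x (m / N) (m % N)) (x 0)
        (j * N + i) = mix (nodeProb (logSize N T) (σ.base j) (σ.expert j)) (nodeCost N T D x j)
        (value N T D σ x j) i := by
      intro i hi
      induction i with
      | zero => exact ih
      | succ i ihi =>
        have hi' : i < N := hi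
        rw [← add_assoc, mix, mix, ihi hi'.le, chainProb, node_div hi', node_mod hi']
    rw [Nat.succ_mul, h N le_rfl, value]

omit hN hT hD in
lemma chainProb_mem (σ : Logs) (m : ℕ) : 0 ≤ chainProb N T σ m ∧ chainProb N T σ m ≤ 1 :=
  ⟨nodeProb_nonneg .., nodeProb_le_one ..⟩

omit hN hT hD in
lemma paddedLoss_mem (hl : IsLossSequence T l) {t : ℕ} (ht : t < T) (i : ℕ) :
    paddedLoss l t i ∈ Set.Icc (0 : ℝ) 1 := by
  unfold paddedLoss
  split_ifs with h
  · exact hl (t + 1) (Finset.mem_Icc.2 ⟨by omega, ht⟩) ⟨i, h⟩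
  · simp

omit hN hT in
/-- The expected loss of a round, with the cost of switching from the action for the node
probabilities `q`, if these are close to those of the round. -/
lemma integral_round_le (hl : IsLossSequence T l) {t : ℕ} (ht : t < T) {q : ℕ → ℝ}
    (hq : ∀ m, 0 ≤ q m ∧ q m ≤ 1)
    (hqt : ∀ m < scaleCount N T D * N, |roundProb N T D l t m - q m|
      ≤ 12 * rate N T D (m / N) * roundProb N T D l t m) :
    ∫ ω, roundLoss D (paddedLoss l t) (chainAction q (· % N) ω (scaleCount N T D * N))
        (chainAction (roundProb N T D l t) (· % N) ω (scaleCount N T D * N)) ∂coinLaw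
      ≤ value N T D (logs N T D (paddedLoss l) t) (paddedLoss l t) (scaleCount N T D) := by
  rw [← mix_chainProb]
  exact integral_roundLoss_le hD
    (fun i => abs_le.2 ⟨by linarith [(paddedLoss_mem hl ht i).1], (paddedLoss_mem hl ht i).2⟩)
    (fun m => m % N) hq (chainProb_mem _) hqt

lemma roundProb_succ_sub_le (hl : IsLossSequence T l) {t : ℕ} (ht : t < T) {m : ℕ}
    (hm : m < scaleCount N T D * N) :
    |roundProb N T D l (t + 1) m - roundProb N T D l t m|
      ≤ 12 * rate N T D (m / N) * roundProb N T D l (t + 1) m :=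
  (scaleRun hN hT hD (fun _ ht i _ => paddedLoss_mem hl ht i)
    ((Nat.div_lt_iff_lt_mul hN).2 hm)).nodeProb_sub_le ht (Nat.mod_lt _ hN)

omit hN hT hD in
lemma sum_Ioc_add_sum_Ioc (f g : ℕ → ℝ) (t₀ k : ℕ) :
    ∑ t ∈ Finset.Ioc t₀ (t₀ + k), f t + D * ∑ t ∈ Finset.Ioc (t₀ + 1) (t₀ + k), g t
      = ∑ t ∈ Finset.Ico t₀ (t₀ + k), (f (t + 1) + D * (if t = t₀ then 0 else g (t + 1))) := by
  induction k with
  | zero => simp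
  | succ k ih =>
    rw [← add_assoc, Finset.sum_Ico_succ_top (by omega), ← ih, Finset.sum_Ioc_succ_top (by omega)]
    rcases Nat.eq_zero_or_pos k with rfl | hk
    · simp
    · rw [Finset.sum_Ioc_succ_top (by omega), if_neg (by omega)]
      ring

/-- The node probabilities before round `t + 1` in an interval that starts with round `t₀ + 1`. -/
noncomputable def previousProb (N T : ℕ) (D : ℝ) (l : ℕ → Fin N → ℝ) (t₀ t : ℕ) : ℕ → ℝ :=
  roundProb N T D l (if t = t₀ then t else t - 1)

/-- The first round of an interval pays for no switch. This is encoded by comparing that round with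
itself, so that every round has the form covered by `integral_round_le`. -/
lemma intervalLoss_eq (l : ℕ → Fin N → ℝ) (ω : ℕ → unitInterval) (t₀ k : ℕ) :
    algorithm.intervalLoss T D l ω t₀ k = ∑ t ∈ Finset.Ico t₀ (t₀ + k),
      roundLoss D (paddedLoss l t)
        (chainAction (previousProb N T D l t₀ t) (· % N) ω (scaleCount N T D * N))
        (chainAction (roundProb N T D l t) (· % N) ω (scaleCount N T D * N)) := by
  rw [Algorithm.intervalLoss, sum_Ioc_add_sum_Ioc]
  refine Finset.sum_congr rfl fun t ht => ?_
  rw [roundLoss, ← action_succ hN hT hD l ω t]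
  congr 2
  by_cases h : t = t₀
  · rw [if_pos h, previousProb, if_pos h, action_succ hN hT hD l ω t, if_neg (not_not.2 rfl)]
  · obtain ⟨t, rfl⟩ : ∃ t', t = t' + 1 := ⟨t - 1, by have := (Finset.mem_Ico.1 ht).1; omega⟩
    rw [if_neg h, previousProb, if_neg h, Nat.add_sub_cancel, Nat.add_sub_cancel,
      ← action_succ hN hT hD l ω t]

lemma algorithm_hasRegretBound {t₀ k : ℕ} (hk : t₀ + k ≤ T) :
    HasRegretBound algorithm N T D t₀ k
      (1000 * Real.sqrt ((D + 1) * k * Real.log ((N : ℝ) * T))) := by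
  intro l hl
  have hx : ∀ t < T, ∀ i < N, paddedLoss l t i ∈ Set.Icc (0 : ℝ) 1 :=
    fun _ ht i _ => paddedLoss_mem hl ht i
  have hint : ∀ t ∈ Finset.Ico t₀ (t₀ + k), MeasureTheory.Integrable (fun ω =>
      roundLoss D (paddedLoss l t)
        (chainAction (previousProb N T D l t₀ t) (· % N) ω (scaleCount N T D * N))
        (chainAction (roundProb N T D l t) (· % N) ω (scaleCount N T D * N))) coinLaw := by
    intro t ht
    have ht' : t < T := by have := (Finset.mem_Ico.1 ht).2; omega
    exact integrable_roundLoss hD (fun i => abs_le.2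
      ⟨by linarith [(paddedLoss_mem hl ht' i).1], (paddedLoss_mem hl ht' i).2⟩) ..
  simp only [intervalLoss_eq hN hT hD]
  refine ⟨MeasureTheory.integrable_finsetSum _ hint, ?_⟩
  rw [MeasureTheory.integral_finsetSum _ hint]
  have hle : ∑ t ∈ Finset.Ico t₀ (t₀ + k), ∫ ω, roundLoss D (paddedLoss l t)
        (chainAction (previousProb N T D l t₀ t) (· % N) ω (scaleCount N T D * N))
        (chainAction (roundProb N T D l t) (· % N) ω (scaleCount N T D * N)) ∂coinLaw
      ≤ ∑ t ∈ Finset.Ico t₀ (t₀ + k),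
        value N T D (logs N T D (paddedLoss l) t) (paddedLoss l t) (scaleCount N T D) := by
    refine Finset.sum_le_sum fun t ht => ?_
    obtain ⟨h1, h2⟩ := Finset.mem_Ico.1 ht
    refine integral_round_le hD hl (by omega) (chainProb_mem _) fun m hm => ?_
    unfold previousProb
    split_ifs with h
    · rw [sub_self, abs_zero]
      exact mul_nonneg (mul_nonneg (by norm_num) (rate_pos hN hT hD _).le) (chainProb_mem _ _).1
    · obtain ⟨t', rfl⟩ : ∃ t', t = t' + 1 := ⟨t - 1, by omega⟩
      exact roundProb_succ_sub_le hN hT hD hl (by omega) hm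
  have : Nonempty (Fin N) := ⟨⟨0, hN⟩⟩
  -- Moving the regret term to the left leaves a lower bound for the infimum, to be checked expert
  -- by expert.
  rw [← sub_le_iff_le_add]
  refine le_ciInf fun i => ?_
  have hreg := sum_value_le hN hT hD hx hk i.2
  have hsum : ∑ t ∈ Finset.Ico t₀ (t₀ + k), paddedLoss l t i
      = ∑ t ∈ Finset.Ioc t₀ (t₀ + k), l t i := by
    have := sum_Ioc_add_sum_Ioc (D := 0) (fun t => l t i) (fun _ => 0) t₀ k
    simp only [zero_mul, add_zero] at this
    rw [this]
    exact Finset.sum_congr rfl fun t _ => by simp [paddedLoss]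
  linarith

end

end Experts

theorem theorem1 :
    ∃ (A : Experts.Algorithm) (C : ℝ), 0 < C ∧
      ∀ (N T : ℕ) (D : ℝ), 1 ≤ N → 2 ≤ T → 0 ≤ D →
        Experts.RunsWithin A N T D (C * ((N : ℝ) * Real.log (T : ℝ))) ∧
        ∀ t₀ k : ℕ, t₀ + k ≤ T →
          Experts.HasRegretBound A N T D t₀ k
            (C * Real.sqrt ((D + 1) * (k : ℝ) * Real.log ((N : ℝ) * (T : ℝ)))) := by
  -- The step count is proved with the constant `10000`; the regret bound holds with `1000` and is
  -- weakened.
  refine ⟨Experts.algorithm, 10000, by norm_num, fun N T D hN hT hD =>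
    ⟨Experts.algorithm_runsWithin hN hT hD, fun t₀ k hk l hl => ?_⟩⟩
  obtain ⟨h1, h2⟩ := Experts.algorithm_hasRegretBound hN hT hD hk l hl
  refine ⟨h1, h2.trans ?_⟩
  gcongr
  norm_num
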